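/- **Setting.** Let $E$ be a finite set of items and $O$ a set of states. A realization is a map $\phi:E\to O$; the random realization $\Phi$ has a known discrete prior $p(\phi)=\Pr[\Phi=\phi]$. A partial realization $\psi$ is a map from a subset $\mathrm{dom}(\psi)\subseteq E$ to $O$; $\psi\prec\phi$ means that $\phi$ extends $\psi$, and $\psi\subseteq\psi'$ that $\psi'$ extends $\psi$. Let $f:2^E\times O^E\to\mathbb R_{\ge 0}$ with $\mathbb E[f(S,\Phi)]<\infty$ for all $S\subseteq E$ (automatic if $O$ is finite). For $\Pr[\psi\prec\Phi]>0$ put $$\Delta(e\mid\psi)=\mathbb E\big[f(\mathrm{dom}(\psi)\cup\{e\},\Phi)-f(\mathrm{dom}(\psi),\Phi)\,\big|\,\psi\prec\Phi\big],\qquad f(e)=\mathbb E[f(\{e\},\Phi)].$$ The function $f$ is *adaptive submodular* with respect to $p$ if $\Delta(e\mid\psi)\ge\Delta(e\mid\psi')$ whenever $\psi\subseteq\psi'$, $\Pr[\psi'\prec\Phi]>0$ and $e\notin\mathrm{dom}(\psi')$. (Neither monotonicity nor submodularity of $f(\cdot,\phi)$ for fixed $\phi$ is assumed.) A (randomized)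 adaptive policy $\pi$ selects items one at a time and observes the state of each selected item; given the partial realization observed so far, it chooses, possibly at random and possibly using internal randomness independent of $\Phi$, the next item or stops. Let $E(\pi,\phi)$ be the random set of items that it selects under $\phi$, and $f_{avg}(\pi)=\mathbb E[f(E(\pi,\Phi),\Phi)]$, the expectation being over $\Phi$ and the randomness of $\pi$. Given costs $c_e>0$ and a budget $b$, the policy is *feasible* if for every $\phi$ with $p(\phi)>0$ one always has $\sum_{e\in E(\pi,\phi)}c_e\le b$. **The policy $\pi^{sad}$** with parameters $\delta_0,\delta_1,\delta_2$. Let $e^*\in\arg\max_{e\in E}f(e)$. Draw $S_1\subseteq E$ containing each item independently with probability $\delta_0$, and let $S_2=E\setminus S_1$. With probability $\delta_1$ select only $e^*$; with probability $\delta_2$ run density-greedy on $S_1$; with probability $1-\delta_1-\delta_2$ run density-greedy on $S_2$. Density-greedy on $S$: given the current observation $\psi$ and the remaining budget $C=b-\sum_{e\in\mathrm{dom}(\psi)}c_e$, let $$F=\{e\in S\setminus\mathrm{dom}(\psi): c_e\le C,\ \Delta(e\mid\psi)>0\};$$ stop if $F=\emptyset$, otherwise select an item of $\arg\max_{e\in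 F}\Delta(e\mid\psi)/c_e$ and observe its state. Ties are broken by an arbitrary linear order on $E$, which may depend on $\psi$ but not on $S$. **Theorem.** Let $E\ne\emptyset$ and let $f$ be adaptive submodular with respect to $p$. Take $\delta_0=1/2$, $\delta_1=1/5$, $\delta_2=2/5$. If $c_{e^*}\le b$ (in particular, if every item fits into the budget), then $\pi^{sad}$ is feasible. Moreover, for every feasible policy $\pi$, in particular for an optimal feasible policy $\pi=\pi^{opt}$, $$f_{avg}(\pi^{sad})\ \ge\ \tfrac1{10}\,f_{avg}(\pi).$$ -/

import Mathlib

open scoped NNReal ENNReal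

noncomputable section

namespace AdaptiveKnapsack

/-- A partial realization: `ψ e = some o` if the state `o` of `e` has been observed,
`ψ e = none` if `e` is not in the domain. -/
abbrev PartialRealization (E O : Type*) := E → Option O

section Realizations

variable {E O : Type*}

/-- The domain of a partial realization. -/
def dom [Fintype E] (ψ : PartialRealization E O) : Finset E :=
  Finset.univ.filter fun e => (ψ e).isSome = true

/-- `ψ ≺ φ`: the partial realization agrees with the realization on its domain. -/
def Consistent (ψ : PartialRealization E O) (φ : E → O) : Prop :=
  ∀ e o, ψ e = some o → φ e = o

/-- `ψ ⊆ ψ'`: `ψ` is a subrealization of `ψ'`. -/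
def Subrealization (ψ ψ' : PartialRealization E O) : Prop :=
  ∀ e o, ψ e = some o → ψ' e = some o

/-- `Pr[ψ ≺ Φ]`. -/
def probConsistent (p : PMF (E → O)) (ψ : PartialRealization E O) : ℝ≥0∞ :=
  p.toOuterMeasure {φ | Consistent ψ φ}

open Classical in
/-- The conditional probability `p(φ ∣ ψ) = Pr[Φ = φ ∣ ψ ≺ Φ]`
(meaningful when `Pr[ψ ≺ Φ] > 0`). -/
def posterior (p : PMF (E → O)) (ψ : PartialRealization E O) (φ : E → O) : ℝ :=
  if Consistent ψ φ then (p φ).toReal / (probConsistent p ψ).toReal else 0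

variable [Fintype E] [DecidableEq E]

/-- The conditional expected marginal utility `Δ(e ∣ ψ)`. -/
def marginal (p : PMF (E → O)) (f : Finset E → (E → O) → ℝ≥0) (e : E)
    (ψ : PartialRealization E O) : ℝ :=
  ∑' φ, posterior p ψ φ * ((f (insert e (dom ψ)) φ : ℝ) - (f (dom ψ) φ : ℝ))

/-- Adaptive submodularity of `f` with respect to `p`. As the conditional expectations must be
defined, only partial realizations of positive probability are compared
(if `ψ'` has positive probability, so does every `ψ ⊆ ψ'`). -/
def AdaptiveSubmodular (p : PMF (E → O)) (f : Finset E → (E → O) → ℝ≥0) : Prop :=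
  ∀ ψ ψ' : PartialRealization E O, Subrealization ψ ψ' → 0 < probConsistent p ψ' →
    ∀ e, e ∉ dom ψ' → marginal p f e ψ' ≤ marginal p f e ψ

/-- Expected utility of a fixed set, `𝔼[f(S, Φ)]`. -/
def expectedUtility (p : PMF (E → O)) (f : Finset E → (E → O) → ℝ≥0) (S : Finset E) : ℝ≥0∞ :=
  ∑' φ, p φ * (f S φ : ℝ≥0∞)

end Realizations

section Policies

variable {E O : Type*}

/-- A decision rule maps the current observation to a distribution over the next item to select;
`none` means that the selection stops. -/
abbrev Rule (E O : Type*) := PartialRealization E O → PMF (Option E)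

/-- An adaptive policy: an initial random draw (independent of the realization) of a decision rule,
which is then followed. A single rule `r` is the policy `PMF.pure r`. -/
abbrev Policy (E O : Type*) := PMF (Rule E O)

variable [Fintype E] [DecidableEq E]

/-- The law of the set of items selected by the rule `r` under the realization `φ`, starting from
the observation `ψ`, with at most `k` further selections. -/
def runFrom (r : Rule E O) (φ : E → O) : ℕ → PartialRealization E O → PMF (Finset E)
  | 0, ψ => PMF.pure (dom ψ)
  | k + 1, ψ => (r ψ).bind fun a =>
      match a with
      | none => PMF.pure (dom ψ)
      | some e => runFrom r φ k (Function.update ψ e (some (φ e)))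

/-- The law of `E(π, φ)`, the random set of items selected by `π` under the realization `φ`.
Since there are `Fintype.card E` items, that many selections always suffice. -/
def selected (π : Policy E O) (φ : E → O) : PMF (Finset E) :=
  π.bind fun r => runFrom r φ (Fintype.card E) (fun _ => none)

/-- The expected utility `f_avg(π)`, over both `Φ ∼ p` and the randomness of `π`. -/
def favg (p : PMF (E → O)) (f : Finset E → (E → O) → ℝ≥0) (π : Policy E O) : ℝ≥0∞ :=
  ∑' φ, p φ * ∑ S : Finset E, selected π φ S * (f S φ : ℝ≥0∞)

/-- Feasibility for the knapsack constraint with costs `c` and budget `b`: under every realization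
of positive probability, every possible set of selected items costs at most `b`. -/
def Feasible (p : PMF (E → O)) (c : E → ℝ) (b : ℝ) (π : Policy E O) : Prop :=
  ∀ φ, 0 < p φ → ∀ S, 0 < selected π φ S → ∑ e ∈ S, c e ≤ b

end Policies

section Sad

variable {E O : Type*} [Fintype E] [DecidableEq E]

/-- The rule that selects the single item `e` and stops. -/
def singletonRule (e : E) : Rule E O :=
  fun ψ => PMF.pure (if e ∈ dom ψ then none else some e)

open Classical in
/-- The candidates of the density-greedy rule on `S` after observing `ψ`: the items of `S` not yet
selected that fit into the remaining budget and have positive conditional expected marginal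
utility. -/
def candidates (p : PMF (E → O)) (f : Finset E → (E → O) → ℝ≥0) (c : E → ℝ) (b : ℝ)
    (S : Finset E) (ψ : PartialRealization E O) : Finset E :=
  (S \ dom ψ).filter fun e => c e ≤ b - ∑ e' ∈ dom ψ, c e' ∧ 0 < marginal p f e ψ

open Classical in
/-- The candidates with the largest benefit-to-cost ratio `Δ(e ∣ ψ) / c_e`. -/
def bestCandidates (p : PMF (E → O)) (f : Finset E → (E → O) → ℝ≥0) (c : E → ℝ) (b : ℝ)
    (S : Finset E) (ψ : PartialRealization E O) : Finset E :=
  (candidates p f c b S ψ).filter fun e =>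
    ∀ e' ∈ candidates p f c b S ψ, marginal p f e' ψ / c e' ≤ marginal p f e ψ / c e

/-- The density-greedy rule on `S`: as long as there is a candidate, select one with the largest
benefit-to-cost ratio. Ties after the observation `ψ` are broken by the linear order `tie ψ`. -/
def greedyRule (p : PMF (E → O)) (f : Finset E → (E → O) → ℝ≥0) (c : E → ℝ) (b : ℝ)
    (tie : PartialRealization E O → LinearOrder E) (S : Finset E) : Rule E O :=
  fun ψ => PMF.pure
    (if h : (bestCandidates p f c b S ψ).Nonempty then
      some (@Finset.min' E (tie ψ) (bestCandidates p f c b S ψ) h)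
    else none)

/-- The law of a random subset of `E` that contains each item independently with
probability `δ`. -/
def randomSubset (E : Type*) [Fintype E] [DecidableEq E] (δ : ℝ≥0) (hδ : δ ≤ 1) :
    PMF (Finset E) :=
  PMF.ofFintype (fun S => ((∏ _e ∈ S, δ) * ∏ _e ∈ Sᶜ, (1 - δ) : ℝ≥0)) (by
    have h := Finset.prod_add (fun _ : E => δ) (fun _ : E => 1 - δ) Finset.univ
    simp only [add_tsub_cancel_of_le hδ, Finset.prod_const_one, Finset.powerset_univ] at h
    rw [← ENNReal.ofNNReal_finsetSum]
    simp only [Finset.compl_eq_univ_sdiff]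
    exact_mod_cast h.symm)

/-- The law of the index of the candidate policy that is adopted: `0`, `1`, `2` with
probabilities `δ₁`, `δ₂`, `1 - δ₁ - δ₂`. -/
def policyIndex (δ₁ δ₂ : ℝ≥0) (h : δ₁ + δ₂ ≤ 1) : PMF (Fin 3) :=
  PMF.ofFintype (fun i => ((![δ₁, δ₂, 1 - (δ₁ + δ₂)] i : ℝ≥0) : ℝ≥0∞)) (by
    rw [← ENNReal.ofNNReal_finsetSum]
    have : ∑ i, ![δ₁, δ₂, 1 - (δ₁ + δ₂)] i = 1 := by
      simp [Fin.sum_univ_three, add_tsub_cancel_of_le h]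
    rw [this]; simp)

/-- The sampling-based adaptive density-greedy policy `π^sad`. It draws a random set `S₁`
(each item independently with probability `δ₀`), `S₂ = E \ S₁`, and adopts: with probability `δ₁`
the selection of the single item `estar`, with probability `δ₂` the density-greedy rule on `S₁`, and
with the remaining probability the density-greedy rule on `S₂`. -/
def sad (p : PMF (E → O)) (f : Finset E → (E → O) → ℝ≥0) (c : E → ℝ) (b : ℝ)
    (tie : PartialRealization E O → LinearOrder E) (estar : E)
    (δ₀ δ₁ δ₂ : ℝ≥0) (h₀ : δ₀ ≤ 1) (h₁₂ : δ₁ + δ₂ ≤ 1) : Policy E O :=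
  (policyIndex δ₁ δ₂ h₁₂).bind fun i =>
    (randomSubset E δ₀ h₀).map fun S₁ =>
      ![singletonRule estar, greedyRule p f c b tie S₁, greedyRule p f c b tie S₁ᶜ] i

end Sad

theorem half_le_one : (1 / 2 : ℝ≥0) ≤ 1 := by
  rw [← NNReal.coe_le_coe]; norm_num

theorem fifths_le_one : (1 / 5 : ℝ≥0) + 2 / 5 ≤ 1 := by
  rw [← NNReal.coe_le_coe]; norm_num

end AdaptiveKnapsack

end

universe u v

namespace AdaptiveKnapsack

/-! ### Partial realizations and their extensions. -/

section PartialRealizations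

variable {E O : Type*}

/-! A randomized rule is a mixture of its choices, so a feasible policy can be replaced by a
deterministic decision tree `t` that selects only sets the policy may select (`exists_tree_ge`,
`Feasible.favg_le`). It remains to bound the value of a tree `t` that respects the budget. Let `g_S`
be the density-greedy tree on `S`, let `M` be the expected utility of the best single item, and
write `f(·)` for expected values.

Without monotonicity, `f(g_S ∪ t)` may be smaller than `f(t)`. However, `g_S` and `g_{Sᶜ}` use
disjoint items, so adaptive submodularity after running `t`, together with `f ≥ 0`, gives `f(t) ≤
f(g_S ∪ t) + f(g_{Sᶜ} ∪ t)` (`condSum_items_le_add`). Averaging over all `S` bounds `f(t)` by twice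
the average of `f(g_S ∪ t)`.

Next, `f(g_S ∪ t) - f(g_S)` is at most the expected sum of the positive final marginals `δ_o` of the
items `o` of `t` not taken by `g_S` (`condSum_union_le_add_sum`). Compare the greedy runs on `S` and
on `S ∪ {o}`: they coincide until `o` is chosen (`marginal_le_itemGain_or`). If `o` is chosen, `δ_o`
is at most its gain in the run on `S ∪ {o}`; summed over `S`, these gains at most double the gains
in the runs on `S` (`sum_insert_le`). Otherwise every item chosen while `o` fits has density at
least `δ_o / c_o`, so `δ_o (b - c_o) ≤ c_o G` with `G` the total gain of the run, hence `δ_o b ≤ c_o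
(G + M)`; as `t` costs at most `b`, these `δ_o` sum to at most `G + M`.

Since expected gains are at most the greedy value, the average of `f(g_S ∪ t)` is at most `(1 + 2 +
1)` times the average greedy value plus `M`. Thus `f(t) ≤ 8 · (average greedy value) + 2M`, which is
ten times the value of the mixture with weights `4/5` and `1/5`. -/

theorem Consistent.update [DecidableEq E] {ψ : PartialRealization E O} {φ : E → O}
    (h : Consistent ψ φ) (e : E) : Consistent (Function.update ψ e (some (φ e))) φ := by
  intro e' o' h'
  by_cases he : e' = e
  · subst he; simpa using h'
  · exact h e' o' (by simpa [he] using h')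

theorem Consistent.of_subrealization {ψ ψ' : PartialRealization E O} {φ : E → O}
    (h : Subrealization ψ ψ') (h' : Consistent ψ' φ) : Consistent ψ φ :=
  fun e o he => h' e o (h e o he)

theorem Subrealization.trans {ψ₁ ψ₂ ψ₃ : PartialRealization E O}
    (h : Subrealization ψ₁ ψ₂) (h' : Subrealization ψ₂ ψ₃) : Subrealization ψ₁ ψ₃ :=
  fun e o he => h' e o (h e o he)

theorem Subrealization.refl (ψ : PartialRealization E O) : Subrealization ψ ψ :=
  fun _ _ h => h

theorem Consistent.apply_of_update [DecidableEq E] {ψ : PartialRealization E O} {φ : E → O}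
    {e : E} {o : O} (h : Consistent (Function.update ψ e (some o)) φ) : φ e = o :=
  h e o (by simp)

theorem Subrealization.consistent_update_iff [DecidableEq E] {ψ : PartialRealization E O}
    {e : E} {o : O} (h : Subrealization ψ (Function.update ψ e (some o))) (φ : E → O) :
    Consistent (Function.update ψ e (some o)) φ ↔ Consistent ψ φ ∧ φ e = o := by
  constructor
  · intro h'
    exact ⟨h'.of_subrealization h, h'.apply_of_update⟩
  · rintro ⟨h', rfl⟩
    exact h'.update e

theorem Consistent.subrealization_update [DecidableEq E] {ψ : PartialRealization E O} {φ : E → O}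
    (h : Consistent ψ φ) (e : E) : Subrealization ψ (Function.update ψ e (some (φ e))) := by
  intro e' o' h'
  by_cases he : e' = e
  · subst he; simp [h _ _ h']
  · simpa [he] using h'

theorem consistent_none (φ : E → O) : Consistent (fun _ => none) φ := by
  intro e o h; simp at h

theorem subrealization_none (ψ : PartialRealization E O) : Subrealization (fun _ => none) ψ := by
  intro e o h; simp at h

/-- The observation of the states of the items in `B` under `φ`. -/
def observe [DecidableEq E] (φ : E → O) (B : Finset E) : PartialRealization E O :=
  fun e => if e ∈ B then some (φ e) else none

theorem consistent_observe [DecidableEq E] (φ : E → O) (B : Finset E) : Consistent (observe φ B) φ := by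
  intro e o h
  by_cases he : e ∈ B <;> simp_all [observe]

variable [Fintype E]

theorem mem_dom {ψ : PartialRealization E O} {e : E} : e ∈ dom ψ ↔ ∃ o, ψ e = some o := by
  simp [dom, Option.isSome_iff_exists]

@[simp] theorem dom_none : dom (fun _ => none : PartialRealization E O) = ∅ := by
  ext e; simp [mem_dom]

variable [DecidableEq E]

@[simp] theorem dom_update (ψ : PartialRealization E O) (e : E) (o : O) :
    dom (Function.update ψ e (some o)) = insert e (dom ψ) := by
  ext e'
  by_cases he : e' = e
  · subst he; simp [mem_dom]
  · simp [mem_dom, he]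

@[simp] theorem dom_observe (φ : E → O) (B : Finset E) : dom (observe φ B) = B := by
  ext e; by_cases h : e ∈ B <;> simp [mem_dom, observe, h]

/-- An observation is recovered from the selected set and the realization, so marginals at the end
of a run can be written as functions of these two. -/
theorem Consistent.observe_dom {ψ : PartialRealization E O} {φ : E → O} (h : Consistent ψ φ) :
    observe φ (dom ψ) = ψ := by
  funext e
  by_cases he : e ∈ dom ψ
  · obtain ⟨o, ho⟩ := mem_dom.1 he
    simp [observe, he, ho, h e o ho]
  · have : ψ e = none := by
      by_contra hne
      exact he (mem_dom.2 (Option.ne_none_iff_exists'.1 hne))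
    simp [observe, he, this]

theorem Consistent.subrealization_observe {ψ : PartialRealization E O} {φ : E → O}
    (h : Consistent ψ φ) {B : Finset E} (hB : dom ψ ⊆ B) : Subrealization ψ (observe φ B) := by
  intro e o ho
  simp [observe, hB (mem_dom.2 ⟨o, ho⟩), h e o ho]

end PartialRealizations

/-! ### Unnormalized conditional expectations. -/

section ConditionalSums

variable {E O : Type*} (p : PMF (E → O))

open Classical in
/-- The unnormalized conditional expectation `𝔼[X(Φ); ψ ≺ Φ]`. -/
noncomputable def condSum (ψ : PartialRealization E O) (X : (E → O) → ℝ) : ℝ :=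
  ∑' φ, if Consistent ψ φ then (p φ).toReal * X φ else 0

/-- Integrability of a real function of the random realization. -/
def Integr (X : (E → O) → ℝ) : Prop := Summable fun φ => (p φ).toReal * X φ

variable {p}

theorem summable_prob : Summable fun φ => (p φ).toReal :=
  ENNReal.summable_toReal p.tsum_coe_ne_top

theorem Integr.add {X Y : (E → O) → ℝ} (hX : Integr p X) (hY : Integr p Y) :
    Integr p fun φ => X φ + Y φ := by
  unfold Integr; simp only [mul_add]; exact Summable.add hX hY

theorem Integr.const_mul {X : (E → O) → ℝ} (a : ℝ) (hX : Integr p X) :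
    Integr p fun φ => a * X φ := by
  unfold Integr; simp only [mul_left_comm]; exact Summable.mul_left a hX

theorem integr_of_bounded {X : (E → O) → ℝ} (C : ℝ) (h : ∀ φ, p φ ≠ 0 → |X φ| ≤ C) :
    Integr p X := by
  refine Summable.of_norm_bounded (g := fun φ => (p φ).toReal * C) (summable_prob.mul_right C) ?_
  intro φ
  rw [norm_mul, Real.norm_of_nonneg ENNReal.toReal_nonneg]
  by_cases hφ : p φ = 0
  · simp [hφ]
  · exact mul_le_mul_of_nonneg_left (h φ hφ) ENNReal.toReal_nonneg

theorem integr_const (C : ℝ) : Integr p fun _ => C := integr_of_bounded |C| fun _ _ => le_rfl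

open Classical in
theorem Integr.summable_ite {X : (E → O) → ℝ} (hX : Integr p X) (s : (E → O) → Prop) :
    Summable fun φ => if s φ then (p φ).toReal * X φ else 0 := by
  have := Summable.indicator hX {φ | s φ}
  refine this.congr fun φ => ?_
  by_cases h : s φ <;> simp [Set.indicator, h]

theorem condSum_add {X Y : (E → O) → ℝ} (hX : Integr p X) (hY : Integr p Y)
    (ψ : PartialRealization E O) :
    condSum p ψ (fun φ => X φ + Y φ) = condSum p ψ X + condSum p ψ Y := by
  classical
  unfold condSum
  rw [← (hX.summable_ite _).tsum_add (hY.summable_ite _)]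
  refine tsum_congr fun φ => ?_
  split_ifs <;> ring

theorem condSum_const_mul (X : (E → O) → ℝ) (a : ℝ) (ψ : PartialRealization E O) :
    condSum p ψ (fun φ => a * X φ) = a * condSum p ψ X := by
  classical
  unfold condSum
  rw [← tsum_mul_left]
  refine tsum_congr fun φ => ?_
  split_ifs <;> ring

/-- Null realizations may be ignored. A consistent `φ` with `p φ ≠ 0` also certifies that `ψ` has
positive probability, which is what adaptive submodularity requires. -/
theorem condSum_mono {X Y : (E → O) → ℝ} (hX : Integr p X) (hY : Integr p Y)
    {ψ : PartialRealization E O} (h : ∀ φ, p φ ≠ 0 → Consistent ψ φ → X φ ≤ Y φ) :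
    condSum p ψ X ≤ condSum p ψ Y := by
  classical
  refine (hX.summable_ite _).tsum_le_tsum (fun φ => ?_) (hY.summable_ite _)
  split_ifs with hc
  · by_cases hφ : p φ = 0
    · simp [hφ]
    · exact mul_le_mul_of_nonneg_left (h φ hφ hc) ENNReal.toReal_nonneg
  · exact le_rfl

theorem condSum_congr {X Y : (E → O) → ℝ} {ψ : PartialRealization E O}
    (h : ∀ φ, Consistent ψ φ → X φ = Y φ) : condSum p ψ X = condSum p ψ Y := by
  classical
  refine tsum_congr fun φ => ?_
  split_ifs with hc
  · rw [h φ hc]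
  · rfl

theorem Integr.sum {ι : Type*} {s : Finset ι} {X : ι → (E → O) → ℝ}
    (h : ∀ i ∈ s, Integr p (X i)) : Integr p fun φ => ∑ i ∈ s, X i φ := by
  unfold Integr
  simp only [Finset.mul_sum]
  exact summable_sum h

theorem condSum_sum {ι : Type*} {s : Finset ι} {X : ι → (E → O) → ℝ}
    (h : ∀ i ∈ s, Integr p (X i)) (ψ : PartialRealization E O) :
    condSum p ψ (fun φ => ∑ i ∈ s, X i φ) = ∑ i ∈ s, condSum p ψ (X i) := by
  classical
  induction s using Finset.induction_on with
  | empty => simp [condSum]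
  | insert i s hi ih =>
    simp only [Finset.sum_insert hi]
    rw [condSum_add (h i (by simp)) (Integr.sum fun j hj => h j (by simp [hj])),
      ih fun j hj => h j (by simp [hj])]

/-- To compare two conditional expectations it suffices to compare them after observing the state
of a further item. -/
theorem condSum_le_of_update [DecidableEq E] {X Y : (E → O) → ℝ} (hX : Integr p X)
    (hY : Integr p Y) {ψ : PartialRealization E O} (e : E)
    (h : ∀ o, Subrealization ψ (Function.update ψ e (some o)) →
      condSum p (Function.update ψ e (some o)) X ≤ condSum p (Function.update ψ e (some o)) Y) :
    condSum p ψ X ≤ condSum p ψ Y := by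
  classical
  -- Split the sum by the state of `e`. If `ψ` already records another state of `e`, the update
  -- overwrites it and does not extend `ψ`; such states contribute zero.
  have key : ∀ {Z : (E → O) → ℝ}, Integr p Z → HasSum (fun o =>
      if Subrealization ψ (Function.update ψ e (some o)) then
        condSum p (Function.update ψ e (some o)) Z else 0) (condSum p ψ Z) := by
    intro Z hZ
    have := (hZ.summable_ite (Consistent ψ)).hasSum.tsum_fiberwise (fun φ => φ e)
    refine Eq.subst (motive := fun g => HasSum g (condSum p ψ Z)) (Eq.symm (funext fun o => ?_)) this
    rw [tsum_subtype ((fun φ : E → O => φ e) ⁻¹' {o})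
      (fun φ => if Consistent ψ φ then (p φ).toReal * Z φ else 0)]
    split_ifs with hs
    · refine tsum_congr fun φ => ?_
      simp only [hs.consistent_update_iff, Set.indicator, Set.mem_preimage, Set.mem_singleton_iff]
      split_ifs <;> simp_all
    · symm
      refine (tsum_congr fun φ => ?_).trans tsum_zero
      simp only [Set.indicator, Set.mem_preimage, Set.mem_singleton_iff]
      split_ifs with h1 h2
      · exact absurd (h1 ▸ h2.subrealization_update e) hs
      · rfl
      · rfl
  refine hasSum_le (fun o => ?_) (key hX) (key hY)
  split_ifs with hs
  · exact h o hs
  · exact le_rfl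

theorem condSum_none (X : (E → O) → ℝ) :
    condSum p (fun _ => none) X = ∑' φ, (p φ).toReal * X φ := by
  classical
  refine tsum_congr fun φ => ?_
  rw [if_pos]
  intro e o h; simp at h

theorem probConsistent_ne_top (ψ : PartialRealization E O) : probConsistent p ψ ≠ ⊤ := by
  refine ne_top_of_le_ne_top ENNReal.one_ne_top ?_
  unfold probConsistent
  rw [PMF.toOuterMeasure_apply, ← p.tsum_coe]
  exact ENNReal.tsum_le_tsum fun φ => Set.indicator_le_self _ _ _

theorem condSum_one (ψ : PartialRealization E O) :
    condSum p ψ (fun _ => 1) = (probConsistent p ψ).toReal := by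
  classical
  unfold probConsistent condSum
  rw [PMF.toOuterMeasure_apply, ENNReal.tsum_toReal_eq]
  · refine tsum_congr fun φ => ?_
    by_cases h : Consistent ψ φ <;> simp [h]
  · intro φ
    by_cases h : Consistent ψ φ <;> simp [h, p.apply_ne_top]

theorem probConsistent_pos {ψ : PartialRealization E O} {φ : E → O} (h : Consistent ψ φ)
    (hφ : p φ ≠ 0) : 0 < probConsistent p ψ := by
  rw [pos_iff_ne_zero]
  intro h0
  unfold probConsistent at h0
  rw [PMF.toOuterMeasure_apply_eq_zero_iff] at h0
  exact Set.disjoint_left.1 h0 ((PMF.mem_support_iff _ _).2 hφ) h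

end ConditionalSums

/-! ### Marginal utilities and integrability. -/

section Marginals

variable {E O : Type*} [Fintype E] {p : PMF (E → O)} {f : Finset E → (E → O) → ℝ≥0}

/-- There are finitely many sets, so the utility of a random set is dominated by the sum of the
utilities of all sets. -/
theorem integr_utility (hint : ∀ S, expectedUtility p f S ≠ ⊤) (B : (E → O) → Finset E) :
    Integr p fun φ => (f (B φ) φ : ℝ) := by
  have h1 : ∀ S, Summable fun φ => (p φ).toReal * (f S φ : ℝ) := by
    intro S
    refine (ENNReal.summable_toReal (hint S)).congr fun φ => ?_
    simp
  refine Summable.of_nonneg_of_le (fun φ => by positivity) (fun φ => ?_)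
    (summable_sum (s := Finset.univ) fun S _ => h1 S)
  exact Finset.single_le_sum (f := fun S => (p φ).toReal * (f S φ : ℝ))
    (fun S _ => by positivity) (Finset.mem_univ (B φ))

variable [DecidableEq E]

theorem marginal_of_mem {e : E} {ψ : PartialRealization E O} (h : e ∈ dom ψ) :
    marginal p f e ψ = 0 := by
  simp [marginal, Finset.insert_eq_of_mem h]

/-- Division by zero makes the posterior vanish, so bounds on marginals can be stated for every `ψ`.
-/
theorem marginal_of_probConsistent_eq_zero {e : E} {ψ : PartialRealization E O}
    (h : probConsistent p ψ = 0) : marginal p f e ψ = 0 := by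
  simp [marginal, posterior, h]

/-- The definition of the marginal with the denominator cleared; for a null `ψ` both sides vanish.
-/
theorem condSum_insert (hint : ∀ S, expectedUtility p f S ≠ ⊤) (e : E)
    (ψ : PartialRealization E O) :
    condSum p ψ (fun φ => (f (insert e (dom ψ)) φ : ℝ)) =
      condSum p ψ (fun φ => (f (dom ψ) φ : ℝ) + marginal p f e ψ) := by
  classical
  have hI := integr_utility hint fun _ => dom ψ
  have hI' := integr_utility hint fun _ => insert e (dom ψ)
  rw [condSum_add hI (integr_const _)]
  by_cases h0 : (probConsistent p ψ).toReal = 0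
  · have hz : ∀ φ, Consistent ψ φ → p φ = 0 := by
      intro φ hφ
      by_contra hne
      exact (ENNReal.toReal_pos (probConsistent_pos hφ hne).ne' (probConsistent_ne_top ψ)).ne' h0
    have : ∀ X, condSum p ψ X = 0 := by
      intro X
      refine (tsum_congr fun φ => ?_).trans tsum_zero
      split_ifs with hc
      · simp [hz φ hc]
      · rfl
    simp [this]
  · have h1 : marginal p f e ψ = (condSum p ψ (fun φ => (f (insert e (dom ψ)) φ : ℝ)) +
        condSum p ψ (fun φ => (-1) * (f (dom ψ) φ : ℝ))) / (probConsistent p ψ).toReal := by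
      rw [← condSum_add hI' (hI.const_mul _)]
      unfold marginal condSum
      rw [← tsum_div_const]
      refine tsum_congr fun φ => ?_
      unfold posterior
      split_ifs
      · ring
      · simp
    have h2 : condSum p ψ (fun _ => marginal p f e ψ)
        = marginal p f e ψ * (probConsistent p ψ).toReal := by
      have := condSum_const_mul (p := p) (fun _ => 1) (marginal p f e ψ) ψ
      simpa [condSum_one] using this
    rw [h2, h1, div_mul_cancel₀ _ h0, condSum_const_mul]
    ring

/-- The marginal utility of an item is at most the expected utility of that item alone. -/
theorem AdaptiveSubmodular.marginal_le (hf : AdaptiveSubmodular p f)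
    (hint : ∀ S, expectedUtility p f S ≠ ⊤) (ψ : PartialRealization E O) (e : E) :
    marginal p f e ψ ≤ (expectedUtility p f {e}).toReal := by
  by_cases hψ : 0 < probConsistent p ψ
  swap
  · rw [marginal_of_probConsistent_eq_zero (by simpa using hψ)]; exact ENNReal.toReal_nonneg
  by_cases he : e ∈ dom ψ
  · rw [marginal_of_mem he]; exact ENNReal.toReal_nonneg
  refine (hf _ ψ (subrealization_none ψ) hψ e he).trans ?_
  have h := condSum_insert hint e (fun _ => none)
  rw [condSum_add (integr_utility hint fun _ => _) (integr_const _)] at h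
  have h1 : condSum p (fun _ => none) (fun _ => marginal p f e (fun _ => none))
      = marginal p f e (fun _ => none) := by
    rw [condSum_none, tsum_mul_right, ← ENNReal.tsum_toReal_eq p.apply_ne_top, p.tsum_coe]; simp
  have h2 : condSum p (fun _ => none) (fun φ => (f (insert e (dom (fun _ => none : PartialRealization E O))) φ : ℝ))
      = (expectedUtility p f {e}).toReal := by
    rw [condSum_none, expectedUtility, ENNReal.tsum_toReal_eq]
    · simp
    · exact fun φ => ENNReal.mul_ne_top (p.apply_ne_top φ) ENNReal.coe_ne_top
  -- The value of the empty set need not be zero, but it is nonnegative and can be dropped.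
  have h3 : 0 ≤ condSum p (fun _ => none) (fun φ => (f (dom (fun _ => none : PartialRealization E O)) φ : ℝ)) := by
    rw [condSum_none]
    exact tsum_nonneg fun φ => by positivity
  rw [h1, h2] at h
  linarith

end Marginals

/-! ### Decision trees and adaptive submodularity. -/

/-- A deterministic adaptive policy, given as a decision tree. -/
inductive DecisionTree (E : Type u) (O : Type v) : Type (max u v)
  | leaf : DecisionTree E O
  | query (e : E) (next : O → DecisionTree E O) : DecisionTree E O

namespace DecisionTree

variable {E : Type u} {O : Type v}

/-- The items selected by a decision tree under the realization `φ`. -/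
def items [DecidableEq E] : DecisionTree E O → (E → O) → Finset E
  | leaf, _ => ∅
  | query e next, φ => insert e (items (next (φ e)) φ)

/-- All items that occur in the tree belong to `S`. -/
def QueriesIn (S : Finset E) : DecisionTree E O → Prop
  | leaf => True
  | query e next => e ∈ S ∧ ∀ o, QueriesIn S (next o)

theorem queriesIn_univ [Fintype E] (t : DecisionTree E O) : t.QueriesIn Finset.univ := by
  induction t with
  | leaf => trivial
  | query e next ih => exact ⟨Finset.mem_univ e, ih⟩

variable [Fintype E] [DecidableEq E]

theorem dom_union_items_query {ψ : PartialRealization E O} {φ : E → O} {e : E} {o : O}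
    (next : O → DecisionTree E O) (h : Consistent (Function.update ψ e (some o)) φ) :
    dom ψ ∪ (query e next).items φ =
      dom (Function.update ψ e (some o)) ∪ (next o).items φ := by
  rw [dom_update, items, h.apply_of_update]
  simp

variable {p : PMF (E → O)} {f : Finset E → (E → O) → ℝ≥0}

/-- To compare conditional expectations of functions of the items selected by a tree, it suffices
to compare them at the leaves. -/
theorem condSum_le_of_leaves {S : Finset E} {X Y : Finset E → (E → O) → ℝ}
    (hX : ∀ B : (E → O) → Finset E, Integr p fun φ => X (B φ) φ)
    (t : DecisionTree E O) (ψ : PartialRealization E O) (ht : t.QueriesIn S)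
    (hY : ∀ B : (E → O) → Finset E, Integr p fun φ => Y (B φ) φ)
    (h : ∀ ψ', Subrealization ψ ψ' → dom ψ' ⊆ dom ψ ∪ S →
      condSum p ψ' (X (dom ψ')) ≤ condSum p ψ' (Y (dom ψ'))) :
    condSum p ψ (fun φ => X (dom ψ ∪ t.items φ) φ) ≤
      condSum p ψ (fun φ => Y (dom ψ ∪ t.items φ) φ) := by
  induction t generalizing ψ with
  | leaf => simpa [items] using h ψ (.refl ψ) Finset.subset_union_left
  | query e next ih =>
    refine condSum_le_of_update (hX _) (hY _) e fun o ho => ?_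
    have hc : ∀ Z : Finset E → (E → O) → ℝ,
        condSum p (Function.update ψ e (some o))
          (fun φ => Z (dom ψ ∪ (query e next).items φ) φ) =
        condSum p (Function.update ψ e (some o))
          (fun φ => Z (dom (Function.update ψ e (some o)) ∪ (next o).items φ) φ) := fun Z =>
      condSum_congr fun φ hφ => by rw [dom_union_items_query next hφ]
    rw [hc X, hc Y]
    refine ih o _ (ht.2 o) fun ψ' h1 h2 => h ψ' (ho.trans h1) (h2.trans ?_)
    rw [dom_update]
    intro x hx
    simp only [Finset.mem_union, Finset.mem_insert] at hx ⊢
    rcases hx with (rfl | hx) | hx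
    · exact Or.inr ht.1
    · exact Or.inl hx
    · exact Or.inr hx

/-- The conditional expected gain of adding an item can only decrease if a tree that does not
contain the item is run before. -/
theorem condSum_insert_items_le (hint : ∀ S, expectedUtility p f S ≠ ⊤)
    (hf : AdaptiveSubmodular p f) {S : Finset E} {t : DecisionTree E O} (ht : t.QueriesIn S)
    {ψ : PartialRealization E O} {e : E} (heS : e ∉ S) (he : e ∉ dom ψ) :
    condSum p ψ (fun φ => (f (insert e (dom ψ ∪ t.items φ)) φ : ℝ)) ≤
      condSum p ψ (fun φ => (f (dom ψ ∪ t.items φ) φ : ℝ) + marginal p f e ψ) := by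
  refine condSum_le_of_leaves (X := fun B φ => (f (insert e B) φ : ℝ))
    (Y := fun B φ => (f B φ : ℝ) + marginal p f e ψ)
    (fun B => integr_utility hint _) t ψ ht
    (fun B => (integr_utility hint _).add (integr_const _)) fun ψ' h1 h2 => ?_
  rw [condSum_insert hint]
  refine condSum_mono ((integr_utility hint _).add (integr_const _))
    ((integr_utility hint _).add (integr_const _)) fun φ hφ hc => ?_
  -- At a leaf the observation has grown from `ψ` to `ψ'` without including `e`, so the marginal of
  -- `e` has not increased.
  have := hf ψ ψ' h1 (probConsistent_pos hc hφ) e fun h => by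
    rcases Finset.mem_union.1 (h2 h) with h | h
    exacts [he h, heS h]
  linarith

/-- Trees on disjoint sets of items have submodular values. -/
theorem condSum_union_add_le (hint : ∀ S, expectedUtility p f S ≠ ⊤)
    (hf : AdaptiveSubmodular p f) {S : Finset E} {g g' : DecisionTree E O} (hg : g.QueriesIn S)
    (hg' : g'.QueriesIn Sᶜ) (ψ : PartialRealization E O) :
    condSum p ψ (fun φ => (f (dom ψ ∪ g.items φ ∪ g'.items φ) φ : ℝ)) +
        condSum p ψ (fun φ => (f (dom ψ) φ : ℝ)) ≤
      condSum p ψ (fun φ => (f (dom ψ ∪ g.items φ) φ : ℝ)) +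
        condSum p ψ (fun φ => (f (dom ψ ∪ g'.items φ) φ : ℝ)) := by
  have hI := fun B : (E → O) → Finset E => integr_utility hint B
  induction g generalizing ψ with
  | leaf => simp [items, add_comm]
  | query e next ih =>
    -- The induction hypothesis after observing the root `e`: both base sets contain `e`. It is
    -- removed below because its gain after `g'` is at most its gain now.
    have h1 : condSum p ψ (fun φ => (f (dom ψ ∪ (query e next).items φ ∪ g'.items φ) φ : ℝ)) +
        condSum p ψ (fun φ => (f (insert e (dom ψ)) φ : ℝ)) ≤
      condSum p ψ (fun φ => (f (dom ψ ∪ (query e next).items φ) φ : ℝ)) +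
        condSum p ψ (fun φ => (f (insert e (dom ψ ∪ g'.items φ)) φ : ℝ)) := by
      rw [← condSum_add (hI _) (hI _), ← condSum_add (hI _) (hI _)]
      refine condSum_le_of_update ((hI _).add (hI _)) ((hI _).add (hI _)) e fun o ho => ?_
      have := ih o (hg.2 o) (Function.update ψ e (some o))
      rw [← condSum_add (hI _) (hI _), ← condSum_add (hI _) (hI _)] at this
      convert this using 1
      · refine condSum_congr fun φ hφ => ?_
        rw [dom_union_items_query next hφ, dom_update]
      · refine condSum_congr fun φ hφ => ?_
        rw [dom_union_items_query next hφ, dom_update, Finset.insert_union,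
          Finset.insert_union]
    by_cases he : e ∈ dom ψ
    · have h2 : ∀ B : Finset E, insert e (dom ψ ∪ B) = dom ψ ∪ B := fun B =>
        Finset.insert_eq_of_mem (Finset.mem_union_left _ he)
      simpa only [h2, Finset.insert_eq_of_mem he] using h1
    · have h2 := condSum_insert_items_le hint hf hg' (by simpa using hg.1) he
      rw [condSum_add (hI _) (integr_const _)] at h2
      have h3 := condSum_insert hint e ψ
      rw [condSum_add (hI _) (integr_const _)] at h3
      linarith

/-- Each of two trees on disjoint sets may follow `t` at the expense of the other one. -/
theorem condSum_items_le_add (hint : ∀ S, expectedUtility p f S ≠ ⊤)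
    (hf : AdaptiveSubmodular p f) {S : Finset E} {g g' : DecisionTree E O} (hg : g.QueriesIn S)
    (hg' : g'.QueriesIn Sᶜ) (t : DecisionTree E O) (ψ : PartialRealization E O) :
    condSum p ψ (fun φ => (f (dom ψ ∪ t.items φ) φ : ℝ)) ≤
      condSum p ψ (fun φ => (f (dom ψ ∪ t.items φ ∪ g.items φ) φ : ℝ)) +
        condSum p ψ (fun φ => (f (dom ψ ∪ t.items φ ∪ g'.items φ) φ : ℝ)) := by
  have hI := fun B : (E → O) → Finset E => integr_utility hint B
  rw [← condSum_add (hI _) (hI _)]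
  refine condSum_le_of_leaves (X := fun B φ => (f B φ : ℝ))
    (Y := fun B φ => (f (B ∪ g.items φ) φ : ℝ) + (f (B ∪ g'.items φ) φ : ℝ))
    hI t ψ t.queriesIn_univ (fun B => (hI _).add (hI _)) fun ψ' _ _ => ?_
  rw [condSum_add (hI _) (hI _)]
  -- At a leaf of `t` submodularity applies, and the value of the union of both trees is
  -- nonnegative.
  refine le_trans ?_ (condSum_union_add_le hint hf hg hg' ψ')
  rw [← condSum_add (hI _) (hI _)]
  exact condSum_mono (hI _) ((hI _).add (hI _)) fun φ _ _ => by
    have := (f (dom ψ' ∪ g.items φ ∪ g'.items φ) φ).coe_nonneg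
    linarith

/-- The gain of a tree is at most the sum of the positive parts of the marginals of its items. -/
theorem condSum_items_le_add_sum (hint : ∀ S, expectedUtility p f S ≠ ⊤)
    (hf : AdaptiveSubmodular p f) (t : DecisionTree E O) {ψ₀ ψ : PartialRealization E O}
    (h : Subrealization ψ₀ ψ) :
    condSum p ψ (fun φ => (f (dom ψ ∪ t.items φ) φ : ℝ)) ≤
      condSum p ψ (fun φ => (f (dom ψ) φ : ℝ) +
        ∑ o ∈ t.items φ \ dom ψ, max (marginal p f o ψ₀) 0) := by
  have hI := fun B : (E → O) → Finset E => integr_utility hint B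
  have hS : ∀ B : (E → O) → Finset E,
      Integr p fun φ => ∑ o ∈ B φ, max (marginal p f o ψ₀) 0 := by
    intro B
    refine integr_of_bounded (∑ o, max (marginal p f o ψ₀) 0) fun φ _ => ?_
    rw [abs_of_nonneg (Finset.sum_nonneg fun _ _ => le_max_right _ _)]
    exact Finset.sum_le_sum_of_subset_of_nonneg (Finset.subset_univ _)
      fun _ _ _ => le_max_right _ _
  induction t generalizing ψ with
  | leaf => simp [items]
  | query e next ih =>
    -- Marginals are taken at the fixed `ψ₀` while `ψ` grows, so the same summands serve throughout
    -- the induction. A repeated query contributes nothing.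
    have h1 : condSum p ψ (fun φ => (f (dom ψ ∪ (query e next).items φ) φ : ℝ)) ≤
        condSum p ψ (fun φ => (f (insert e (dom ψ)) φ : ℝ) +
          ∑ o ∈ (query e next).items φ \ insert e (dom ψ), max (marginal p f o ψ₀) 0) := by
      refine condSum_le_of_update (hI _) ((hI _).add (hS _)) e fun o ho => ?_
      convert ih o (h.trans ho) using 1
      · refine condSum_congr fun φ hφ => ?_
        rw [dom_union_items_query next hφ]
      · refine condSum_congr fun φ hφ => ?_
        rw [dom_update, items, hφ.apply_of_update,
          Finset.insert_sdiff_of_mem _ (Finset.mem_insert_self _ _)]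
    by_cases he : e ∈ dom ψ
    · simpa only [Finset.insert_eq_of_mem he] using h1
    · refine h1.trans ?_
      rw [condSum_add (hI _) (hS _), condSum_insert hint,
        ← condSum_add ((hI _).add (integr_const _)) (hS _)]
      refine condSum_mono (((hI _).add (integr_const _)).add (hS _)) ((hI _).add (hS _))
        fun φ hφ hc => ?_
      have h2 : (query e next).items φ \ dom ψ =
          insert e ((query e next).items φ \ insert e (dom ψ)) := by
        ext x
        by_cases hx : x = e
        · subst hx; simp [items, he]
        · simp [items, hx]
      rw [h2, Finset.sum_insert (by simp)]
      have := hf ψ₀ ψ h (probConsistent_pos hc hφ) e he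
      have := le_max_left (marginal p f e ψ₀) 0
      linarith

/-- The gain of running `t` after `g` is bounded by the marginals after the final observation
of `g`. -/
theorem condSum_union_le_add_sum (hint : ∀ S, expectedUtility p f S ≠ ⊤)
    (hf : AdaptiveSubmodular p f) (g t : DecisionTree E O) (ψ : PartialRealization E O) :
    condSum p ψ (fun φ => (f (dom ψ ∪ g.items φ ∪ t.items φ) φ : ℝ)) ≤
      condSum p ψ (fun φ => (f (dom ψ ∪ g.items φ) φ : ℝ) +
        ∑ o ∈ t.items φ \ (dom ψ ∪ g.items φ),
          max (marginal p f o (observe φ (dom ψ ∪ g.items φ))) 0) := by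
  have hI := fun B : (E → O) → Finset E => integr_utility hint B
  refine condSum_le_of_leaves (X := fun B φ => (f (B ∪ t.items φ) φ : ℝ))
    (Y := fun B φ => (f B φ : ℝ) + ∑ o ∈ t.items φ \ B, max (marginal p f o (observe φ B)) 0)
    (fun B => hI _) g ψ g.queriesIn_univ (fun B => (hI _).add ?_) fun ψ' _ _ => ?_
  -- The final marginals depend on `φ`; the singleton utilities bound them uniformly.
  · refine integr_of_bounded (∑ o, (expectedUtility p f {o}).toReal) fun φ _ => ?_
    rw [abs_of_nonneg (Finset.sum_nonneg fun _ _ => le_max_right _ _)]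
    refine (Finset.sum_le_sum fun o _ => max_le (hf.marginal_le hint _ o)
      ENNReal.toReal_nonneg).trans ?_
    exact Finset.sum_le_sum_of_subset_of_nonneg (Finset.subset_univ _)
      fun _ _ _ => ENNReal.toReal_nonneg
  · refine (condSum_items_le_add_sum hint hf t (.refl ψ')).trans_eq ?_
    exact condSum_congr fun φ hφ => by rw [hφ.observe_dom]

/-- The conditional marginal utility of the item `o` at the moment when it is selected by the tree,
started at the observation `ψ`, under the realization `φ`. -/
noncomputable def itemGain (p : PMF (E → O)) (f : Finset E → (E → O) → ℝ≥0) :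
    DecisionTree E O → PartialRealization E O → (E → O) → E → ℝ
  | leaf, _, _, _ => 0
  | query e next, ψ, φ, o => (if o = e then marginal p f e ψ else 0) +
      itemGain p f (next (φ e)) (Function.update ψ e (some (φ e))) φ o

theorem sum_itemGain_query (p : PMF (E → O)) (f : Finset E → (E → O) → ℝ≥0) (e : E)
    (next : O → DecisionTree E O) (ψ : PartialRealization E O) (φ : E → O) :
    ∑ o, itemGain p f (query e next) ψ φ o = marginal p f e ψ +
      ∑ o, itemGain p f (next (φ e)) (Function.update ψ e (some (φ e))) φ o := by
  simp [itemGain, Finset.sum_add_distrib]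

end DecisionTree

open DecisionTree

/-! ### The density-greedy tree. -/

section Greedy

variable {E : Type u} {O : Type v} [Fintype E] [DecidableEq E]
  (p : PMF (E → O)) (f : Finset E → (E → O) → ℝ≥0) (c : E → ℝ) (b : ℝ)
  (tie : PartialRealization E O → LinearOrder E)

/-- The item selected by the density-greedy rule. -/
noncomputable def greedyChoice (S : Finset E) (ψ : PartialRealization E O) : Option E :=
  if h : (bestCandidates p f c b S ψ).Nonempty then
    some (@Finset.min' E (tie ψ) (bestCandidates p f c b S ψ) h)
  else none

/-- The decision tree of the density-greedy rule on `S`, with at most `k` selections. -/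
noncomputable def greedyTree (S : Finset E) : ℕ → PartialRealization E O → DecisionTree E O
  | 0, _ => leaf
  | k + 1, ψ => match greedyChoice p f c b tie S ψ with
    | none => leaf
    | some e => query e fun o => greedyTree S k (Function.update ψ e (some o))

variable {p f c b tie} {S : Finset E}

theorem mem_candidates {ψ : PartialRealization E O} {e : E} :
    e ∈ candidates p f c b S ψ ↔
      e ∈ S ∧ e ∉ dom ψ ∧ c e ≤ b - ∑ e' ∈ dom ψ, c e' ∧ 0 < marginal p f e ψ := by
  classical
  simp [candidates, and_assoc]

theorem mem_bestCandidates {ψ : PartialRealization E O} {e : E} :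
    e ∈ bestCandidates p f c b S ψ ↔ e ∈ candidates p f c b S ψ ∧
      ∀ e' ∈ candidates p f c b S ψ, marginal p f e' ψ / c e' ≤ marginal p f e ψ / c e := by
  classical
  simp [bestCandidates]

theorem greedyChoice_eq_some_iff {ψ : PartialRealization E O} {e : E} :
    greedyChoice p f c b tie S ψ = some e ↔ e ∈ bestCandidates p f c b S ψ ∧
      ∀ e' ∈ bestCandidates p f c b S ψ, (tie ψ).le e e' := by
  let _ := tie ψ
  unfold greedyChoice
  split_ifs with h
  · rw [Option.some_inj]
    constructor
    · rintro rfl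
      exact ⟨Finset.min'_mem _ h, fun e' he' => Finset.min'_le _ e' he'⟩
    · rintro ⟨h1, h2⟩
      exact (tie ψ).le_antisymm _ _ (Finset.min'_le _ _ h1) (h2 _ (Finset.min'_mem _ h))
  · simp only [false_iff]
    rintro ⟨h1, -⟩
    exact h ⟨e, h1⟩

theorem greedyChoice_ne_none {ψ : PartialRealization E O}
    (h : (candidates p f c b S ψ).Nonempty) : greedyChoice p f c b tie S ψ ≠ none := by
  obtain ⟨e, he, hmax⟩ := Finset.exists_max_image _ (fun e => marginal p f e ψ / c e) h
  have : (bestCandidates p f c b S ψ).Nonempty := ⟨e, mem_bestCandidates.2 ⟨he, hmax⟩⟩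
  simp [greedyChoice, this]

/-- If the greedy choice from `S ∪ {o}` is not `o`, it is also the greedy choice from `S`. -/
theorem greedyChoice_of_insert {ψ : PartialRealization E O} {e o : E}
    (h : greedyChoice p f c b tie (insert o S) ψ = some e) (heo : e ≠ o) :
    greedyChoice p f c b tie S ψ = some e := by
  rw [greedyChoice_eq_some_iff] at h ⊢
  obtain ⟨h1, h2⟩ := h
  rw [mem_bestCandidates] at h1
  have hsub : ∀ x ∈ candidates p f c b S ψ, x ∈ candidates p f c b (insert o S) ψ := by
    intro x hx
    rw [mem_candidates] at hx ⊢
    exact ⟨Finset.mem_insert_of_mem hx.1, hx.2⟩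
  have he : e ∈ candidates p f c b S ψ := by
    have := mem_candidates.1 h1.1
    exact mem_candidates.2 ⟨(Finset.mem_insert.1 this.1).resolve_left heo, this.2⟩
  -- Since `e` lies in `S`, the maximal density is the same for both ground sets, so the best
  -- candidates of `S` are best for `S ∪ {o}`. The tie-breaking order depends only on `ψ`, hence
  -- selects `e` again.
  refine ⟨mem_bestCandidates.2 ⟨he, fun x hx => h1.2 x (hsub x hx)⟩, fun x hx => h2 x ?_⟩
  rw [mem_bestCandidates] at hx ⊢
  exact ⟨hsub x hx.1, fun y hy => (h1.2 y hy).trans (hx.2 e he)⟩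

theorem greedyChoice_mem {ψ : PartialRealization E O} {e : E}
    (h : greedyChoice p f c b tie S ψ = some e) :
    e ∈ S ∧ e ∉ dom ψ ∧ c e ≤ b - ∑ e' ∈ dom ψ, c e' ∧ 0 < marginal p f e ψ :=
  mem_candidates.1 (mem_bestCandidates.1 (greedyChoice_eq_some_iff.1 h).1).1

theorem greedyTree_of_none {ψ : PartialRealization E O} {k : ℕ}
    (h : greedyChoice p f c b tie S ψ = none) : greedyTree p f c b tie S (k + 1) ψ = leaf := by
  rw [greedyTree, h]

theorem greedyTree_of_some {ψ : PartialRealization E O} {k : ℕ} {e : E}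
    (h : greedyChoice p f c b tie S ψ = some e) : greedyTree p f c b tie S (k + 1) ψ =
      query e fun o => greedyTree p f c b tie S k (Function.update ψ e (some o)) := by
  rw [greedyTree, h]

theorem queriesIn_greedyTree (k : ℕ) (ψ : PartialRealization E O) :
    (greedyTree p f c b tie S k ψ).QueriesIn S := by
  induction k generalizing ψ with
  | zero => trivial
  | succ k ih =>
    rcases h : greedyChoice p f c b tie S ψ with _ | e
    · rw [greedyTree_of_none h]; trivial
    · rw [greedyTree_of_some h]; exact ⟨(greedyChoice_mem h).1, fun o => ih _⟩

/-- The items selected by the density-greedy tree fit into the budget. -/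
theorem cost_greedyTree_le (k : ℕ) (ψ : PartialRealization E O) (φ : E → O)
    (hψ : ∑ e ∈ dom ψ, c e ≤ b) :
    ∑ e ∈ dom ψ ∪ (greedyTree p f c b tie S k ψ).items φ, c e ≤ b := by
  induction k generalizing ψ with
  | zero => simpa [greedyTree, items] using hψ
  | succ k ih =>
    rcases h : greedyChoice p f c b tie S ψ with _ | e
    · simpa [greedyTree_of_none h, items] using hψ
    · obtain ⟨-, he, hb, -⟩ := greedyChoice_mem h
      have := ih (Function.update ψ e (some (φ e))) (by
        rw [dom_update, Finset.sum_insert he]; linarith)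
      rw [greedyTree_of_some h, items]
      simpa using this

theorem runFrom_greedyRule (k : ℕ) (ψ : PartialRealization E O) (φ : E → O) :
    runFrom (greedyRule p f c b tie S) φ k ψ =
      PMF.pure (dom ψ ∪ (greedyTree p f c b tie S k ψ).items φ) := by
  induction k generalizing ψ with
  | zero => simp [runFrom, greedyTree, items]
  | succ k ih =>
    have hr : greedyRule p f c b tie S ψ = PMF.pure (greedyChoice p f c b tie S ψ) := rfl
    rw [runFrom, hr, PMF.pure_bind]
    rcases h : greedyChoice p f c b tie S ψ with _ | e
    · simp [greedyTree_of_none h, items]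
    · rw [greedyTree_of_some h, items]
      simp [ih]

theorem itemGain_greedyTree_nonneg (k : ℕ) (ψ : PartialRealization E O) (φ : E → O) (o : E) :
    0 ≤ itemGain p f (greedyTree p f c b tie S k ψ) ψ φ o := by
  induction k generalizing ψ with
  | zero => simp [greedyTree, itemGain]
  | succ k ih =>
    rcases h : greedyChoice p f c b tie S ψ with _ | e
    · simp [greedyTree_of_none h, itemGain]
    · rw [greedyTree_of_some h, itemGain]
      refine add_nonneg ?_ (ih _)
      split_ifs
      · exact (greedyChoice_mem h).2.2.2.le
      · exact le_rfl

theorem sum_itemGain_greedyTree_nonneg (k : ℕ) (ψ : PartialRealization E O) (φ : E → O) :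
    0 ≤ ∑ o, itemGain p f (greedyTree p f c b tie S k ψ) ψ φ o :=
  Finset.sum_nonneg fun o _ => itemGain_greedyTree_nonneg k ψ φ o

/-- A crude bound, one marginal per level, needed only for integrability. -/
theorem itemGain_greedyTree_le {M : ℝ} (hM0 : 0 ≤ M) (hM : ∀ e ψ, marginal p f e ψ ≤ M) (k : ℕ)
    (ψ : PartialRealization E O) (φ : E → O) (o : E) :
    itemGain p f (greedyTree p f c b tie S k ψ) ψ φ o ≤ k * M := by
  induction k generalizing ψ with
  | zero => simp [greedyTree, itemGain]
  | succ k ih =>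
    rcases h : greedyChoice p f c b tie S ψ with _ | e
    · simp only [greedyTree_of_none h, itemGain]; positivity
    · rw [greedyTree_of_some h, itemGain]
      have h1 := ih (Function.update ψ e (some (φ e)))
      have h2 : (if o = e then marginal p f e ψ else 0) ≤ M := by
        split_ifs
        · exact hM e ψ
        · exact hM0
      push_cast
      linarith

theorem integr_itemGain_greedyTree (hint : ∀ S, expectedUtility p f S ≠ ⊤)
    (hf : AdaptiveSubmodular p f) (k : ℕ) (ψ : PartialRealization E O) (o : E) :
    Integr p fun φ => itemGain p f (greedyTree p f c b tie S k ψ) ψ φ o := by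
  refine integr_of_bounded (k * ∑ e, (expectedUtility p f {e}).toReal) fun φ _ => ?_
  rw [abs_of_nonneg (itemGain_greedyTree_nonneg k ψ φ o)]
  refine itemGain_greedyTree_le (Finset.sum_nonneg fun _ _ => ENNReal.toReal_nonneg)
    (fun e ψ => (hf.marginal_le hint ψ e).trans ?_) k ψ φ o
  exact Finset.single_le_sum (f := fun e => (expectedUtility p f {e}).toReal)
    (fun _ _ => ENNReal.toReal_nonneg) (Finset.mem_univ e)

/-- The expected sum of the gains of the items is at most the gain in utility. -/
theorem condSum_add_sum_itemGain_le (hint : ∀ S, expectedUtility p f S ≠ ⊤)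
    (hf : AdaptiveSubmodular p f) (k : ℕ) (ψ : PartialRealization E O) :
    condSum p ψ (fun φ => (f (dom ψ) φ : ℝ) +
        ∑ o, itemGain p f (greedyTree p f c b tie S k ψ) ψ φ o) ≤
      condSum p ψ (fun φ => (f (dom ψ ∪ (greedyTree p f c b tie S k ψ).items φ) φ : ℝ)) := by
  have hI := fun B : (E → O) → Finset E => integr_utility hint B
  have hG := fun k ψ => Integr.sum (s := Finset.univ) fun o _ =>
    integr_itemGain_greedyTree (c := c) (b := b) (tie := tie) (S := S) hint hf k ψ o
  induction k generalizing ψ with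
  | zero => simp [greedyTree, itemGain, items]
  | succ k ih =>
    rcases h : greedyChoice p f c b tie S ψ with _ | e
    · simp [greedyTree_of_none h, itemGain, items]
    · have hG' := hG (k + 1) ψ
      rw [greedyTree_of_some h] at hG' ⊢
      set next := fun o => greedyTree p f c b tie S k (Function.update ψ e (some o)) with hnext
      have hrest : Integr p fun φ =>
          ∑ o, itemGain p f (next (φ e)) (Function.update ψ e (some (φ e))) φ o := by
        refine (hG'.add (integr_const (-marginal p f e ψ))).congr fun φ => ?_
        beta_reduce
        rw [sum_itemGain_query]; ring
      -- In expectation, the root's marginal turns the utility of the current set into that of the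
      -- set with `e` inserted.
      have h1 : condSum p ψ (fun φ => (f (dom ψ) φ : ℝ) +
          ∑ o, itemGain p f (query e next) ψ φ o) =
          condSum p ψ (fun φ => (f (insert e (dom ψ)) φ : ℝ) +
            ∑ o, itemGain p f (next (φ e)) (Function.update ψ e (some (φ e))) φ o) := by
        rw [condSum_add (hI _) hrest, condSum_insert hint,
          ← condSum_add ((hI _).add (integr_const _)) hrest]
        refine condSum_congr fun φ _ => ?_
        rw [sum_itemGain_query]; ring
      rw [h1]
      refine condSum_le_of_update ((hI _).add hrest) (hI _) e fun o _ => ?_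
      convert ih (Function.update ψ e (some o)) using 1
      · refine condSum_congr fun φ hφ => ?_
        rw [dom_update, hφ.apply_of_update]
      · refine condSum_congr fun φ hφ => ?_
        rw [dom_union_items_query next hφ]

/-- An item that is not selected by the greedy tree is either selected when it is added to the
ground set, or its marginal is bounded in terms of the gain of the greedy tree. -/
theorem marginal_le_itemGain_or (hf : AdaptiveSubmodular p f) (hc : ∀ e, 0 < c e) {k : ℕ}
    {ψ : PartialRealization E O} {φ : E → O} (hψ : Consistent ψ φ) (hφ : p φ ≠ 0)
    (hk : (dom ψ)ᶜ.card ≤ k) {o : E} {B : Finset E}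
    (hB : B = dom ψ ∪ (greedyTree p f c b tie S k ψ).items φ) (ho : o ∉ B)
    (hpos : 0 < marginal p f o (observe φ B)) :
    marginal p f o (observe φ B) ≤
        itemGain p f (greedyTree p f c b tie (insert o S) k ψ) ψ φ o ∨
      marginal p f o (observe φ B) * (b - ∑ e ∈ dom ψ, c e - c o) ≤
        c o * ∑ e, itemGain p f (greedyTree p f c b tie S k ψ) ψ φ e := by
  -- `B` and `δ` belong to the end of the run and stay fixed while `ψ` advances along it.
  set δ := marginal p f o (observe φ B) with hδ
  induction k generalizing ψ with
  | zero =>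
    -- Enough steps remain to select every unobserved item, so the bound `k` never ends the run
    -- while `o` is unselected.
    have h0 : (dom ψ)ᶜ = ∅ := Finset.card_eq_zero.1 (Nat.le_zero.1 hk)
    have : o ∈ (dom ψ)ᶜ := by
      rw [Finset.mem_compl]
      exact fun h => ho (hB ▸ Finset.mem_union_left _ h)
    simp [h0] at this
  | succ k ih =>
    have hsub : dom ψ ⊆ B := hB ▸ Finset.subset_union_left
    have hoψ : o ∉ dom ψ := fun h => ho (hsub h)
    have hle : δ ≤ marginal p f o ψ :=
      hf _ _ (hψ.subrealization_observe hsub) (probConsistent_pos (consistent_observe φ B) hφ) o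
        (by simpa using ho)
    by_cases hfit : c o ≤ b - ∑ e ∈ dom ψ, c e
    swap
    -- Once `o` no longer fits, the left-hand side is nonpositive.
    · right
      have h1 := mul_nonneg (hc o).le (sum_itemGain_greedyTree_nonneg (p := p) (f := f) (c := c)
        (b := b) (tie := tie) (S := S) (k + 1) ψ φ)
      refine le_trans ?_ h1
      exact mul_nonpos_of_nonneg_of_nonpos hpos.le (by linarith)
    have hcand : o ∈ candidates p f c b (insert o S) ψ :=
      mem_candidates.2 ⟨Finset.mem_insert_self _ _, hoψ, hfit, hpos.trans_le hle⟩
    obtain ⟨e, he⟩ := Option.ne_none_iff_exists'.1 (greedyChoice_ne_none (tie := tie) ⟨o, hcand⟩)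
    rw [greedyTree_of_some he, itemGain]
    have hrest := itemGain_greedyTree_nonneg (p := p) (f := f) (c := c) (b := b) (tie := tie)
      (S := insert o S) k (Function.update ψ e (some (φ e))) φ o
    by_cases heo : e = o
    · left
      subst heo
      rw [if_pos rfl]
      linarith
    -- Both runs select the same `e`, whose density is at least that of `o`. So `c o` times the gain
    -- of `e` pays for `δ * c e`, the amount by which the left-hand side drops when `e` uses up
    -- budget.
    · have heS := greedyChoice_of_insert he heo
      obtain ⟨-, heψ, -, hepos⟩ := greedyChoice_mem heS
      have hdens := (mem_bestCandidates.1 (greedyChoice_eq_some_iff.1 he).1).2 o hcand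
      rw [div_le_div_iff₀ (hc o) (hc e)] at hdens
      rw [greedyTree_of_some heS] at hB ⊢
      rw [sum_itemGain_query, if_neg (Ne.symm heo), zero_add]
      have hψ' := hψ.update e
      rw [dom_union_items_query _ hψ'] at hB
      have hcard : (dom (Function.update ψ e (some (φ e))))ᶜ.card ≤ k := by
        rw [dom_update, Finset.compl_insert, Finset.card_erase_of_mem (by simpa using heψ)]
        omega
      refine (ih hψ' hcard hB).imp id fun h => ?_
      rw [dom_update, Finset.sum_insert heψ] at h
      have h2 : δ * c e ≤ marginal p f o ψ * c e := mul_le_mul_of_nonneg_right hle (hc e).le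
      have h3 : δ * (b - (c e + ∑ e ∈ dom ψ, c e) - c o) + δ * c e =
        δ * (b - ∑ e ∈ dom ψ, c e - c o) := by ring
      rw [mul_add]
      linarith

end Greedy

/-! ### Averaging over ground sets. -/

section Averaging

variable {E : Type u} {O : Type v} [Fintype E] [DecidableEq E]
  {p : PMF (E → O)} {f : Finset E → (E → O) → ℝ≥0} {c : E → ℝ} {b : ℝ}
  {tie : PartialRealization E O → LinearOrder E} {S : Finset E}

/-- Adding an item to the ground set at most doubles the sum over all ground sets. -/
theorem sum_insert_le {F : Finset E → ℝ} (hF : ∀ S, 0 ≤ F S) (o : E) :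
    ∑ S, F (insert o S) ≤ 2 * ∑ S, F S := by
  -- Pair each set avoiding `o` with the set obtained by inserting `o`: the left-hand sum counts the
  -- latter twice, and the former has nonnegative value.
  have hu : (Finset.univ : Finset (Finset E)) =
      (insert o (Finset.univ.erase o)).powerset := by
    rw [Finset.insert_erase (Finset.mem_univ o), Finset.powerset_univ]
  rw [hu, Finset.sum_powerset_insert (by simp), Finset.sum_powerset_insert (by simp)]
  have h := Finset.sum_nonneg fun t (_ : t ∈ (Finset.univ.erase o).powerset) => hF t
  simp only [Finset.insert_idem]
  linarith

/-- The items of a tree that respects the budget add little to the result of the greedy tree. -/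
theorem sum_marginal_le (hf : AdaptiveSubmodular p f) (hc : ∀ e, 0 < c e) {M : ℝ} (hM : ∀ e ψ, marginal p f e ψ ≤ M) (hM0 : 0 ≤ M)
    {φ : E → O} (hφ : p φ ≠ 0) {R B : Finset E} (hR : ∑ e ∈ R, c e ≤ b)
    (hB : B = (greedyTree p f c b tie S (Fintype.card E) (fun _ => none)).items φ) :
    ∑ o ∈ R \ B, max (marginal p f o (observe φ B)) 0 ≤
      ∑ o, itemGain p f (greedyTree p f c b tie (insert o S) (Fintype.card E) (fun _ => none))
          (fun _ => none) φ o +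
        ∑ o, itemGain p f (greedyTree p f c b tie S (Fintype.card E) (fun _ => none))
          (fun _ => none) φ o + M := by
  set H := fun o => itemGain p f
    (greedyTree p f c b tie (insert o S) (Fintype.card E) (fun _ => none)) (fun _ => none) φ o
  set G := ∑ o, itemGain p f (greedyTree p f c b tie S (Fintype.card E) (fun _ => none))
    (fun _ => none) φ o with hG
  have hH : ∀ o, 0 ≤ H o := fun o => itemGain_greedyTree_nonneg _ _ φ o
  have hG0 : 0 ≤ G := sum_itemGain_greedyTree_nonneg _ _ φ
  rcases (R \ B).eq_empty_or_nonempty with h0 | ⟨o₀, ho₀⟩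
  · rw [h0, Finset.sum_empty]
    have := Finset.sum_nonneg fun o (_ : o ∈ Finset.univ) => hH o
    change 0 ≤ ∑ o, H o + G + M
    linarith
  -- An item left in `R` has positive cost within the budget, which justifies dividing by `b`.
  have hb : 0 < b := ((hc o₀).trans_le
    (Finset.single_le_sum (fun e _ => (hc e).le) (Finset.mem_sdiff.1 ho₀).1)).trans_le hR
  have hitem : ∀ o ∈ R \ B, max (marginal p f o (observe φ B)) 0 ≤
      H o + c o * ((G + M) / b) := by
    intro o ho
    have hq : 0 ≤ c o * ((G + M) / b) := by have := hc o; positivity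
    refine max_le ?_ (add_nonneg (hH o) hq)
    by_cases hpos : 0 < marginal p f o (observe φ B)
    swap
    · exact (not_lt.1 hpos).trans (add_nonneg (hH o) hq)
    rcases marginal_le_itemGain_or (b := b) (S := S) (tie := tie) hf hc (consistent_none φ) hφ
      (k := Fintype.card E) (Finset.card_le_univ _) (by simpa using hB) (Finset.mem_sdiff.1 ho).2
      hpos with h | h
    · exact h.trans (le_add_of_nonneg_right hq)
    · refine le_add_of_nonneg_of_le (hH o) ?_
      rw [dom_none, Finset.sum_empty, sub_zero] at h
      -- Add `δ * c o ≤ c o * M` to `δ * (b - c o) ≤ c o * G`, where `δ` is the final marginal of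
      -- `o`. Bounding this part by `M` is what the singleton branch of the policy pays for.
      rw [← mul_div_assoc, le_div_iff₀ hb, mul_add]
      have := mul_le_mul_of_nonneg_left (hM o (observe φ B)) (hc o).le
      linarith
  refine (Finset.sum_le_sum hitem).trans ?_
  rw [Finset.sum_add_distrib, ← Finset.sum_mul, add_assoc]
  refine add_le_add (Finset.sum_le_sum_of_subset_of_nonneg (Finset.subset_univ _)
    fun o _ _ => hH o) ?_
  have h1 : ∑ o ∈ R \ B, c o ≤ b := (Finset.sum_le_sum_of_subset_of_nonneg
    Finset.sdiff_subset fun o _ _ => (hc o).le).trans hR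
  calc (∑ o ∈ R \ B, c o) * ((G + M) / b) ≤ b * ((G + M) / b) :=
        mul_le_mul_of_nonneg_right h1 (by positivity)
    _ = G + M := by field_simp

/-- The expected utility of the density-greedy tree on `S`. -/
noncomputable def greedyValue (p : PMF (E → O)) (f : Finset E → (E → O) → ℝ≥0) (c : E → ℝ) (b : ℝ)
    (tie : PartialRealization E O → LinearOrder E) (S : Finset E) : ℝ :=
  condSum p (fun _ => none) fun φ =>
    (f ((greedyTree p f c b tie S (Fintype.card E) (fun _ => none)).items φ) φ : ℝ)

/-- Any tree that respects the budget is bounded by the average of the greedy trees and the best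
item. -/
theorem card_mul_condSum_le (hint : ∀ S, expectedUtility p f S ≠ ⊤)
    (hf : AdaptiveSubmodular p f) (hc : ∀ e, 0 < c e) {M : ℝ}
    (hM : ∀ e ψ, marginal p f e ψ ≤ M) (hM0 : 0 ≤ M) {t : DecisionTree E O}
    (ht : ∀ φ, p φ ≠ 0 → ∑ e ∈ t.items φ, c e ≤ b) :
    Fintype.card (Finset E) * condSum p (fun _ => none) (fun φ => (f (t.items φ) φ : ℝ)) ≤
      8 * ∑ S, greedyValue p f c b tie S + 2 * Fintype.card (Finset E) * M := by
  set ψ₀ : PartialRealization E O := fun _ => none with hψ₀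
  set gt := fun S => greedyTree p f c b tie S (Fintype.card E) ψ₀ with hgt
  have hd : dom ψ₀ = ∅ := dom_none
  have hI := fun B : (E → O) → Finset E => integr_utility hint B
  have hIG : ∀ S o, Integr p fun φ => itemGain p f (gt S) ψ₀ φ o := fun S o =>
    integr_itemGain_greedyTree hint hf _ _ o
  set gain : Finset E → E → ℝ := fun S o => condSum p ψ₀ fun φ => itemGain p f (gt S) ψ₀ φ o
    with hgain
  have hgain0 : ∀ S o, 0 ≤ gain S o := by
    intro S o
    simp only [hgain, hψ₀, condSum_none]
    exact tsum_nonneg fun φ => mul_nonneg ENNReal.toReal_nonneg (itemGain_greedyTree_nonneg _ _ φ o)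
  have hgainle : ∀ S, ∑ o, gain S o ≤ greedyValue p f c b tie S := by
    intro S
    have h := condSum_add_sum_itemGain_le (c := c) (b := b) (tie := tie) (S := S) hint hf
      (Fintype.card E) ψ₀
    rw [condSum_add (hI _) (Integr.sum fun o _ => hIG S o), condSum_sum fun o _ => hIG S o] at h
    simp only [hd, Finset.empty_union] at h
    have h0 : 0 ≤ condSum p ψ₀ fun φ => (f ∅ φ : ℝ) := by
      rw [hψ₀, condSum_none]
      exact tsum_nonneg fun φ => by positivity
    have : ∑ o, gain S o ≤ condSum p ψ₀ fun φ => (f ((gt S).items φ) φ : ℝ) := by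
      linarith
    exact this
  have hunion : ∀ S, condSum p ψ₀ (fun φ => (f ((gt S).items φ ∪ t.items φ) φ : ℝ)) ≤
      greedyValue p f c b tie S + (∑ o, gain (insert o S) o + ∑ o, gain S o + M) := by
    intro S
    have h := condSum_union_le_add_sum hint hf (gt S) t ψ₀
    simp only [hd, Finset.empty_union] at h
    refine h.trans ?_
    have hIH : Integr p fun φ => ∑ o, itemGain p f (gt (insert o S)) ψ₀ φ o :=
      Integr.sum fun o _ => hIG (insert o S) o
    have hIS : Integr p fun φ => ∑ o, itemGain p f (gt S) ψ₀ φ o := Integr.sum fun o _ => hIG S o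
    have hM1 : condSum p ψ₀ (fun _ => M) = M := by
      rw [hψ₀, condSum_none, tsum_mul_right, ← ENNReal.tsum_toReal_eq p.apply_ne_top, p.tsum_coe]
      simp
    have hR : condSum p ψ₀ (fun φ => (f ((gt S).items φ) φ : ℝ) +
        (∑ o, itemGain p f (gt (insert o S)) ψ₀ φ o + ∑ o, itemGain p f (gt S) ψ₀ φ o + M)) =
        greedyValue p f c b tie S + (∑ o, gain (insert o S) o + ∑ o, gain S o + M) := by
      rw [condSum_add (hI _) ((hIH.add hIS).add (integr_const M)),
        condSum_add (hIH.add hIS) (integr_const M), condSum_add hIH hIS, hM1,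
        condSum_sum fun o _ => hIG (insert o S) o, condSum_sum fun o _ => hIG S o]
      rfl
    rw [← hR]
    refine condSum_mono ((hI _).add ?_)
      ((hI _).add ((hIH.add hIS).add (integr_const M))) fun φ hφ _ => ?_
    · refine integr_of_bounded (∑ _o : E, M) fun φ _ => ?_
      rw [abs_of_nonneg (Finset.sum_nonneg fun _ _ => le_max_right _ _)]
      exact (Finset.sum_le_sum fun o _ => max_le (hM o _) hM0).trans
        (Finset.sum_le_sum_of_subset_of_nonneg (Finset.subset_univ _) fun _ _ _ => hM0)
    · exact add_le_add_right (sum_marginal_le hf hc hM hM0 hφ (ht φ hφ) rfl) _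
  have hswap : ∑ S, ∑ o, gain (insert o S) o ≤ 2 * ∑ S, ∑ o, gain S o := by
    have h : ∑ S, ∑ o, gain S o = ∑ o, ∑ S, gain S o := Finset.sum_comm
    rw [h, Finset.sum_comm, Finset.mul_sum]
    exact Finset.sum_le_sum fun o _ => sum_insert_le (fun S => hgain0 S o) o
  have hsplit : ∀ S, condSum p ψ₀ (fun φ => (f (t.items φ) φ : ℝ)) ≤
      condSum p ψ₀ (fun φ => (f ((gt S).items φ ∪ t.items φ) φ : ℝ)) +
        condSum p ψ₀ (fun φ => (f ((gt Sᶜ).items φ ∪ t.items φ) φ : ℝ)) := by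
    intro S
    have h := condSum_items_le_add hint hf (g := gt S) (g' := gt Sᶜ) (queriesIn_greedyTree _ _)
      (queriesIn_greedyTree _ _) t ψ₀
    simpa only [hd, Finset.empty_union, Finset.union_comm (t.items _)] using h
  have h1 := Finset.sum_le_sum fun S (_ : S ∈ Finset.univ) => hsplit S
  rw [Finset.sum_add_distrib, Finset.sum_const, nsmul_eq_mul, Finset.card_univ] at h1
  -- Complementation permutes the ground sets, so both halves of the split have the same sum.
  have h2 : ∑ S, condSum p ψ₀ (fun φ => (f ((gt Sᶜ).items φ ∪ t.items φ) φ : ℝ)) =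
      ∑ S, condSum p ψ₀ (fun φ => (f ((gt S).items φ ∪ t.items φ) φ : ℝ)) :=
    (compl_bijective (α := Finset E)).sum_comp
      fun S => condSum p ψ₀ (fun φ => (f ((gt S).items φ ∪ t.items φ) φ : ℝ))
  have h3 := Finset.sum_le_sum fun S (_ : S ∈ Finset.univ) => hunion S
  simp only [Finset.sum_add_distrib, Finset.sum_const, nsmul_eq_mul, Finset.card_univ] at h3
  have h4 := Finset.sum_le_sum fun S (_ : S ∈ Finset.univ) => hgainle S
  rw [h2] at h1
  -- Each union costs one greedy value, two from the inserted gains, one from the gains on `S`, and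
  -- one `M`; the split doubles these to `8` and `2`.
  linarith

end Averaging

end AdaptiveKnapsack

/-- An average with respect to a probability vector is at most some value in its support. -/
theorem PMF.exists_sum_le {α : Type*} [Fintype α] (μ : PMF α) (F : α → ℝ≥0∞) :
    ∃ a ∈ μ.support, ∑ a', μ a' * F a' ≤ F a := by
  classical
  obtain ⟨a₀, ha₀⟩ := μ.support_nonempty
  obtain ⟨a, ha, hmax⟩ := Finset.exists_max_image (Finset.univ.filter (· ∈ μ.support)) F
    ⟨a₀, by simpa using ha₀⟩
  refine ⟨a, by simpa using ha, ?_⟩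
  calc ∑ a', μ a' * F a' ≤ ∑ a', μ a' * F a := by
        refine Finset.sum_le_sum fun a' _ => ?_
        by_cases h : μ a' = 0
        · simp [h]
        · gcongr
          exact hmax a' (by simpa using h)
    _ = F a := by rw [← Finset.sum_mul, ← tsum_fintype (L := .unconditional _), μ.tsum_coe, one_mul]

namespace AdaptiveKnapsack

open DecisionTree

/-! ### Values of mixed and deterministic policies. -/

section Values

variable {E : Type u} {O : Type v} [Fintype E]
  {p : PMF (E → O)} {f : Finset E → (E → O) → ℝ≥0}

theorem ofReal_condSum_utility (hint : ∀ S, expectedUtility p f S ≠ ⊤)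
    (B : (E → O) → Finset E) :
    ENNReal.ofReal (condSum p (fun _ => none) fun φ => (f (B φ) φ : ℝ)) =
      ∑' φ, p φ * (f (B φ) φ : ℝ≥0∞) := by
  rw [condSum_none, ENNReal.ofReal_tsum_of_nonneg (fun φ => by positivity) (integr_utility hint B)]
  refine tsum_congr fun φ => ?_
  rw [ENNReal.ofReal_mul ENNReal.toReal_nonneg, ENNReal.ofReal_toReal (p.apply_ne_top φ),
    ENNReal.ofReal_coe_nnreal]

variable [DecidableEq E]

theorem favg_of_selected_eq_pure {π : Policy E O} {B : (E → O) → Finset E}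
    (h : ∀ φ, selected π φ = PMF.pure (B φ)) :
    favg p f π = ∑' φ, p φ * (f (B φ) φ : ℝ≥0∞) := by
  unfold favg
  refine tsum_congr fun φ => ?_
  simp [h φ, PMF.pure_apply]

theorem selected_pure (r : Rule E O) (φ : E → O) :
    selected (PMF.pure r) φ = runFrom r φ (Fintype.card E) (fun _ => none) := by
  rw [selected, PMF.pure_bind]

theorem favg_bind {α : Type*} (μ : PMF α) (κ : α → Policy E O) :
    favg p f (μ.bind κ) = ∑' a, μ a * favg p f (κ a) := by
  have h : ∀ φ S, selected (μ.bind κ) φ S = ∑' a, μ a * selected (κ a) φ S := by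
    intro φ S
    unfold selected
    rw [PMF.bind_bind, PMF.bind_apply]
  simp only [favg, h, ← ENNReal.tsum_mul_left, ← tsum_fintype (L := .unconditional _),
    ← ENNReal.tsum_mul_right]
  conv_rhs => rw [ENNReal.tsum_comm]
  refine tsum_congr fun φ => ?_
  rw [ENNReal.tsum_comm]
  refine tsum_congr fun a => tsum_congr fun S => ?_
  ring

theorem selected_greedyRule {c : E → ℝ} {b : ℝ} {tie : PartialRealization E O → LinearOrder E}
    (S : Finset E) (φ : E → O) : selected (PMF.pure (greedyRule p f c b tie S)) φ =
      PMF.pure ((greedyTree p f c b tie S (Fintype.card E) (fun _ => none)).items φ) := by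
  rw [selected_pure, runFrom_greedyRule, dom_none, Finset.empty_union]

theorem selected_singletonRule (e : E) (φ : E → O) :
    selected (PMF.pure (singletonRule e)) φ = PMF.pure {e} := by
  have : Nonempty E := ⟨e⟩
  obtain ⟨k, hk⟩ := Nat.exists_eq_succ_of_ne_zero (Fintype.card_ne_zero (α := E))
  rw [selected_pure, hk, Nat.succ_eq_add_one, runFrom, singletonRule, PMF.pure_bind]
  simp only [dom_none, Finset.notMem_empty, if_false]
  -- With a single item the step bound ends the run; otherwise the rule stops at its second call.
  cases k with
  | zero => simp [runFrom]
  | succ k => simp [runFrom, singletonRule, PMF.pure_bind]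

end Values

/-! ### Replacing a randomized policy by a decision tree. -/

section Derandomization

variable {E : Type u} {O : Type v} [Fintype E]
  (p : PMF (E → O)) (f : Finset E → (E → O) → ℝ≥0)

open Classical in
/-- The contribution of the realizations consistent with `ψ` to the expected utility, if a random
set with law `L φ` is selected under `φ`. -/
noncomputable def condUtility (ψ : PartialRealization E O) (L : (E → O) → PMF (Finset E)) : ℝ≥0∞ :=
  ∑' φ, if Consistent ψ φ then p φ * ∑ S, L φ S * (f S φ : ℝ≥0∞) else 0

variable {p f}

theorem condUtility_congr {ψ : PartialRealization E O} {L L' : (E → O) → PMF (Finset E)}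
    (h : ∀ φ, Consistent ψ φ → L φ = L' φ) : condUtility p f ψ L = condUtility p f ψ L' := by
  classical
  refine tsum_congr fun φ => ?_
  split_ifs with hc
  · rw [h φ hc]
  · rfl

/-- The random choice is independent of the realization, so the value is linear in it. Extended
nonnegative values allow the sums to be exchanged without integrability. -/
theorem condUtility_bind {α : Type*} [Fintype α] (ψ : PartialRealization E O) (μ : PMF α)
    (L : α → (E → O) → PMF (Finset E)) :
    condUtility p f ψ (fun φ => μ.bind fun a => L a φ) = ∑ a, μ a * condUtility p f ψ (L a) := by
  classical
  unfold condUtility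
  simp only [← ENNReal.tsum_mul_left, ← tsum_fintype (L := .unconditional _)]
  rw [ENNReal.tsum_comm]
  refine tsum_congr fun φ => ?_
  split_ifs
  · simp only [PMF.bind_apply, ← ENNReal.tsum_mul_left, ← ENNReal.tsum_mul_right]
    rw [ENNReal.tsum_comm]
    refine tsum_congr fun a => tsum_congr fun S => ?_
    ring
  · simp

variable [DecidableEq E]

theorem condUtility_le_of_update {ψ : PartialRealization E O} (e : E)
    {L L' : (E → O) → PMF (Finset E)}
    (h : ∀ o, Subrealization ψ (Function.update ψ e (some o)) →
      condUtility p f (Function.update ψ e (some o)) L ≤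
        condUtility p f (Function.update ψ e (some o)) L') :
    condUtility p f ψ L ≤ condUtility p f ψ L' := by
  classical
  have key : ∀ L, condUtility p f ψ L = ∑' o,
      if Subrealization ψ (Function.update ψ e (some o)) then
        condUtility p f (Function.update ψ e (some o)) L else 0 := by
    intro L
    have h1 : ∀ o, (if Subrealization ψ (Function.update ψ e (some o)) then
        condUtility p f (Function.update ψ e (some o)) L else 0) =
        ∑' φ : E → O, if o = φ e then
          (if Consistent ψ φ then p φ * ∑ S, L φ S * (f S φ : ℝ≥0∞) else 0) else 0 := by
      intro o
      split_ifs with hs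
      · refine tsum_congr fun φ => ?_
        simp only [hs.consistent_update_iff, and_comm (b := φ e = o), ite_and, eq_comm (a := o)]
      · refine ((tsum_congr fun φ => ?_).trans tsum_zero).symm
        split_ifs with h1 h2
        · exact absurd (h1 ▸ h2.subrealization_update e) hs
        · rfl
        · rfl
    simp only [h1]
    rw [ENNReal.tsum_comm]
    refine tsum_congr fun φ => ?_
    rw [tsum_ite_eq]
  rw [key L, key L']
  refine ENNReal.tsum_le_tsum fun o => ?_
  split_ifs with hs
  · exact h o hs
  · exact le_rfl

/-- Every decision rule is dominated by a decision tree that selects only sets that the rule may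
select. -/
theorem exists_tree_ge (r : Rule E O) (k : ℕ) (ψ : PartialRealization E O) :
    ∃ t : DecisionTree E O,
      (∀ φ, Consistent ψ φ → dom ψ ∪ t.items φ ∈ (runFrom r φ k ψ).support) ∧
      condUtility p f ψ (fun φ => runFrom r φ k ψ) ≤
        condUtility p f ψ (fun φ => PMF.pure (dom ψ ∪ t.items φ)) := by
  induction k generalizing ψ with
  | zero => exact ⟨.leaf, by simp [runFrom, items]⟩
  | succ k ih =>
    let branch : Option E → (E → O) → PMF (Finset E) := fun a φ =>
      match a with
      | none => PMF.pure (dom ψ)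
      | some e => runFrom r φ k (Function.update ψ e (some (φ e)))
    have hrun : ∀ φ, runFrom r φ (k + 1) ψ = (r ψ).bind fun a => branch a φ := fun φ => rfl
    simp only [hrun]
    rw [condUtility_bind]
    -- Commit to an option that is at least as good as the average. It must lie in the support so
    -- that the tree inherits feasibility.
    obtain ⟨a, ha, hle⟩ := PMF.exists_sum_le (r ψ) fun a => condUtility p f ψ (branch a)
    suffices h : ∃ t : DecisionTree E O,
        (∀ φ, Consistent ψ φ → dom ψ ∪ t.items φ ∈ (branch a φ).support) ∧
        condUtility p f ψ (branch a) ≤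
          condUtility p f ψ (fun φ => PMF.pure (dom ψ ∪ t.items φ)) by
      obtain ⟨t, ht, ht'⟩ := h
      exact ⟨t, fun φ hφ => (PMF.mem_support_bind_iff _ _ _).2 ⟨a, ha, ht φ hφ⟩, hle.trans ht'⟩
    cases a with
    | none => exact ⟨.leaf, by simp [branch, items], by simp [branch, items]⟩
    | some e =>
      choose next hmem hval using fun o => ih (Function.update ψ e (some o))
      refine ⟨.query e next, fun φ hφ => ?_, ?_⟩
      · rw [dom_union_items_query next (hφ.update e)]
        exact hmem (φ e) φ (hφ.update e)
      · refine condUtility_le_of_update e fun o _ => ?_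
        convert hval o using 1
        · exact condUtility_congr fun φ hφ => by
            simp only [branch, hφ.apply_of_update]
        · exact condUtility_congr fun φ hφ => by rw [dom_union_items_query next hφ]

theorem favg_pure_eq_condUtility (r : Rule E O) : favg p f (PMF.pure r) =
    condUtility p f (fun _ => none) fun φ => runFrom r φ (Fintype.card E) (fun _ => none) := by
  classical
  refine tsum_congr fun φ => ?_
  rw [if_pos (consistent_none φ), selected_pure]

/-- A bound for all trees that respect the budget holds for all feasible policies. -/
theorem Feasible.favg_le {c : E → ℝ} {b : ℝ} {π : Policy E O} (hπ : Feasible p c b π) {K : ℝ≥0∞}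
    (h : ∀ t : DecisionTree E O, (∀ φ, p φ ≠ 0 → ∑ e ∈ t.items φ, c e ≤ b) →
      ∑' φ, p φ * (f (t.items φ) φ : ℝ≥0∞) ≤ K) : favg p f π ≤ K := by
  classical
  have hrule : ∀ r ∈ π.support, favg p f (PMF.pure r) ≤ K := by
    intro r hr
    obtain ⟨t, ht, hle⟩ := exists_tree_ge (p := p) (f := f) r (Fintype.card E) (fun _ => none)
    rw [favg_pure_eq_condUtility]
    refine hle.trans ?_
    simp only [dom_none, Finset.empty_union] at ht ⊢
    refine le_trans (le_of_eq (tsum_congr fun φ => ?_)) (h t fun φ hφ => ?_)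
    · rw [if_pos (consistent_none φ)]
      simp [PMF.pure_apply]
    · refine hπ φ (pos_iff_ne_zero.2 hφ) _ (pos_iff_ne_zero.2 ?_)
      exact (PMF.mem_support_iff _ _).1
        ((PMF.mem_support_bind_iff _ _ _).2 ⟨r, hr, ht φ (consistent_none φ)⟩)
  -- The initial draw is a mixture of rules in the support, each bounded by `K`.
  rw [← PMF.bind_pure π, favg_bind]
  calc ∑' r, π r * favg p f (PMF.pure r) ≤ ∑' r, π r * K := by
        refine ENNReal.tsum_le_tsum fun r => ?_
        by_cases hr : π r = 0
        · simp [hr]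
        · gcongr
          exact hrule r hr
    _ = K := by rw [ENNReal.tsum_mul_right, π.tsum_coe, one_mul]

end Derandomization

/-! ### Feasibility and value of the sampling policy. -/

section Sad

variable {E : Type u} {O : Type v} [Fintype E] [DecidableEq E]
  {p : PMF (E → O)} {f : Finset E → (E → O) → ℝ≥0} {c : E → ℝ} {b : ℝ}
  {tie : PartialRealization E O → LinearOrder E}

theorem feasible_sad {estar : E} (hb : 0 ≤ b) (he : c estar ≤ b) {δ₀ δ₁ δ₂ : ℝ≥0} (h₀ : δ₀ ≤ 1)
    (h₁₂ : δ₁ + δ₂ ≤ 1) : Feasible p c b (sad p f c b tie estar δ₀ δ₁ δ₂ h₀ h₁₂) := by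
  intro φ _ S hS
  have hg : ∀ S₁, S ∈ (selected (PMF.pure (greedyRule p f c b tie S₁)) φ).support →
      ∑ e ∈ S, c e ≤ b := by
    intro S₁ h
    rw [selected_greedyRule, PMF.support_pure, Set.mem_singleton_iff] at h
    subst h
    simpa using cost_greedyTree_le (p := p) (f := f) (tie := tie) (S := S₁) (Fintype.card E)
      (fun _ => none) φ (by simpa using hb)
  have hmem : S ∈ (selected (sad p f c b tie estar δ₀ δ₁ δ₂ h₀ h₁₂) φ).support :=
    (PMF.mem_support_iff _ _).2 hS.ne'
  rw [selected, PMF.mem_support_bind_iff] at hmem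
  obtain ⟨r, hr, hS⟩ := hmem
  rw [← selected_pure] at hS
  rw [sad, PMF.mem_support_bind_iff] at hr
  obtain ⟨i, -, hr⟩ := hr
  rw [PMF.mem_support_map_iff] at hr
  obtain ⟨S₁, -, rfl⟩ := hr
  fin_cases i
  · have h : S ∈ (selected (PMF.pure (singletonRule estar)) φ).support := hS
    rw [selected_singletonRule, PMF.support_pure, Set.mem_singleton_iff] at h
    simpa [h] using he
  · exact hg S₁ hS
  · exact hg S₁ᶜ hS

/-- For sampling probability `1/2` the ground set is uniform, which matches the unweighted sums over
`S` in `card_mul_condSum_le`. -/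
theorem randomSubset_half_apply (S : Finset E) :
    randomSubset E (1 / 2) half_le_one S = (Fintype.card (Finset E) : ℝ≥0∞)⁻¹ := by
  have h : (1 : ℝ≥0) - 1 / 2 = 1 / 2 := by
    rw [← NNReal.coe_inj, NNReal.coe_sub half_le_one]; norm_num
  rw [randomSubset, PMF.ofFintype_apply, h, Finset.prod_mul_prod_compl S fun _ : E => (1 / 2 : ℝ≥0)]
  rw [Finset.prod_const, Finset.card_univ, Fintype.card_finset]
  rw [one_div, inv_pow, ENNReal.coe_inv (by positivity)]
  push_cast
  rfl

/-- `S₁` and its complement are both uniform, so the two greedy branches have the same value and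
their weights `2/5` add up to `4/5`. -/
theorem favg_sad (hint : ∀ S, expectedUtility p f S ≠ ⊤) (estar : E) :
    favg p f (sad p f c b tie estar (1 / 2) (1 / 5) (2 / 5) half_le_one fifths_le_one) =
      ENNReal.ofReal (1 / 5 * (expectedUtility p f {estar}).toReal +
        4 / 5 * ((Fintype.card (Finset E) : ℝ)⁻¹ * ∑ S, greedyValue p f c b tie S)) := by
  have hN : (0 : ℝ) < Fintype.card (Finset E) := by exact_mod_cast Fintype.card_pos
  have hg0 : ∀ S, 0 ≤ greedyValue p f c b tie S := fun S => by
    rw [greedyValue, condSum_none]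
    exact tsum_nonneg fun φ => by positivity
  have hgreedy : ∀ S, favg p f (PMF.pure (greedyRule p f c b tie S)) =
      ENNReal.ofReal (greedyValue p f c b tie S) := fun S => by
    rw [favg_of_selected_eq_pure (selected_greedyRule S), greedyValue, ofReal_condSum_utility hint]
  have hsingle : favg p f (PMF.pure (singletonRule estar)) =
      ENNReal.ofReal (expectedUtility p f {estar}).toReal := by
    rw [favg_of_selected_eq_pure (selected_singletonRule estar), ENNReal.ofReal_toReal (hint _)]
    rfl
  have hmap : ∀ (r : Finset E → Rule E O) (v : Finset E → ℝ), (∀ S, 0 ≤ v S) →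
      (∀ S, favg p f (PMF.pure (r S)) = ENNReal.ofReal (v S)) →
      favg p f ((randomSubset E (1 / 2) half_le_one).map r) =
        ENNReal.ofReal ((Fintype.card (Finset E) : ℝ)⁻¹ * ∑ S, v S) := by
    intro r v hv h
    rw [← PMF.bind_pure_comp, favg_bind, tsum_fintype]
    simp only [Function.comp, h, randomSubset_half_apply]
    rw [← Finset.mul_sum, ENNReal.ofReal_mul (by positivity), ENNReal.ofReal_inv_of_pos hN,
      ENNReal.ofReal_natCast, ENNReal.ofReal_sum_of_nonneg fun S _ => hv S]
  have hidx : ∀ i, policyIndex (1 / 5) (2 / 5) fifths_le_one i =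
      ENNReal.ofReal (![1 / 5, 2 / 5, 2 / 5] i) := by
    have h : (1 : ℝ≥0) - (1 / 5 + 2 / 5) = 2 / 5 := by
      rw [← NNReal.coe_inj, NNReal.coe_sub fifths_le_one]; norm_num
    intro i
    rw [policyIndex, PMF.ofFintype_apply, h, ← ENNReal.ofReal_coe_nnreal]
    fin_cases i <;> simp
  have h0 := hmap (fun _ => singletonRule estar) (fun _ => (expectedUtility p f {estar}).toReal)
    (fun _ => ENNReal.toReal_nonneg) fun _ => hsingle
  have h1 := hmap (fun S => greedyRule p f c b tie S) _ hg0 hgreedy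
  have h2 := hmap (fun S => greedyRule p f c b tie Sᶜ) _ (fun S => hg0 Sᶜ) fun S => hgreedy Sᶜ
  rw [(compl_bijective (α := Finset E)).sum_comp (greedyValue p f c b tie)] at h2
  rw [Finset.sum_const, Finset.card_univ, nsmul_eq_mul, inv_mul_cancel_left₀ hN.ne'] at h0
  have hs0 : 0 ≤ (Fintype.card (Finset E) : ℝ)⁻¹ * ∑ S, greedyValue p f c b tie S :=
    mul_nonneg (by positivity) (Finset.sum_nonneg fun S _ => hg0 S)
  rw [sad, favg_bind, tsum_fintype, Fin.sum_univ_three]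
  simp only [hidx, Matrix.cons_val_zero, Matrix.cons_val_one, Matrix.cons_val_two,
    Matrix.head_cons, Matrix.tail_cons]
  rw [h0, h1, h2, ← ENNReal.ofReal_mul (by norm_num), ← ENNReal.ofReal_mul (by norm_num),
    ← ENNReal.ofReal_add (by positivity) (by positivity),
    ← ENNReal.ofReal_add (by positivity) (by positivity)]
  congr 1
  ring

end Sad

end AdaptiveKnapsack

open AdaptiveKnapsack in
theorem mainTheorem1 {E O : Type*} [Fintype E] [DecidableEq E]
    (p : PMF (E → O)) (f : Finset E → (E → O) → ℝ≥0)
    (hint : ∀ S, AdaptiveKnapsack.expectedUtility p f S ≠ ⊤)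
    (hf : AdaptiveKnapsack.AdaptiveSubmodular p f)
    (c : E → ℝ) (hc : ∀ e, 0 < c e) (b : ℝ)
    (tie : AdaptiveKnapsack.PartialRealization E O → LinearOrder E)
    (estar : E)
    (hstar : ∀ e, AdaptiveKnapsack.expectedUtility p f {e} ≤
      AdaptiveKnapsack.expectedUtility p f {estar}) :
    (c estar ≤ b →
      AdaptiveKnapsack.Feasible p c b
        (AdaptiveKnapsack.sad p f c b tie estar (1 / 2) (1 / 5) (2 / 5)
          AdaptiveKnapsack.half_le_one AdaptiveKnapsack.fifths_le_one)) ∧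
    ∀ π : AdaptiveKnapsack.Policy E O, AdaptiveKnapsack.Feasible p c b π →
      (1 / 10 : ℝ≥0∞) * AdaptiveKnapsack.favg p f π ≤
        AdaptiveKnapsack.favg p f
          (AdaptiveKnapsack.sad p f c b tie estar (1 / 2) (1 / 5) (2 / 5)
            AdaptiveKnapsack.half_le_one AdaptiveKnapsack.fifths_le_one) := by
  refine ⟨fun he => feasible_sad ((hc estar).le.trans he) he _ _, fun π hπ => ?_⟩
  have hM : ∀ e ψ, marginal p f e ψ ≤ (expectedUtility p f {estar}).toReal := fun e ψ =>
    (hf.marginal_le hint ψ e).trans (ENNReal.toReal_mono (hint _) (hstar e))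
  have hfav := hπ.favg_le (f := f) (K := 10 * favg p f
    (sad p f c b tie estar (1 / 2) (1 / 5) (2 / 5) half_le_one fifths_le_one)) fun t ht => by
      have h := card_mul_condSum_le (tie := tie) hint hf hc hM ENNReal.toReal_nonneg ht
      have hN : (0 : ℝ) < Fintype.card (Finset E) := by exact_mod_cast Fintype.card_pos
      rw [favg_sad hint, ← ofReal_condSum_utility hint t.items,
        show (10 : ℝ≥0∞) = ENNReal.ofReal 10 by simp, ← ENNReal.ofReal_mul (by norm_num)]
      refine ENNReal.ofReal_le_ofReal ?_
      -- The weights are tuned to the bound: `10 * (1/5) = 2` for the best item and `10 * (4/5) = 8`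
      -- for the average greedy value.
      refine le_of_mul_le_mul_left (h.trans_eq ?_) hN
      field_simp
      ring
  calc (1 / 10 : ℝ≥0∞) * favg p f π ≤ 1 / 10 * (10 * favg p f
        (sad p f c b tie estar (1 / 2) (1 / 5) (2 / 5) half_le_one fifths_le_one)) := by gcongr
    _ = _ := by
      rw [← mul_assoc, ENNReal.div_mul_cancel (by simp) (by simp), one_mul]
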